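/- Let $r\ge 2$ be a fixed integer. An exact $r$-CNF formula $\mathcal C$ is a finite set of $m$ clauses, each consisting of exactly $r$ distinct literals, no two of them complementary. An ordered pair of distinct clauses has a conflict if some literal of one clause occurs negated in the other; it has an overlap if the two clauses have a common literal but no conflict. The conflict number $\mathrm{cn}(\mathcal C)$ is the number of ordered pairs of distinct clauses having a conflict minus the number of ordered pairs of distinct clauses having an overlap. In the problem Exact $r$-SAT Above Tight Lower Bound, an instance is an exact $r$-CNF formula $\mathcal C$ with $m$ clauses and a positive rational number $k$ of the form $K/2^r$ with $K$ a positive integer; the parameter is $k$, and the question is whether some truth assignment satisfies at least $(1-2^{-r})m+k$ clauses of $\mathcal C$. Theorem. This problem, restricted to formulas with $\mathrm{cn}(\mathcal C)\le (2^r-2)m$, admits a quadratic kernel. That is, there is a polynomial-time computable map that takes each instance $(\mathcal C,k)$ of the restricted problem to an instance $(\mathcal C',k')$ of the restricted problem with the same answer, such that $k'\le k$, the size of $(\mathcal C',k')$ is bounded by a function of $k$, and the number $m'$ of clauses of $\mathcal C'$ satisfies $$m' < 16\cdot 256^r k^2 ;$$ moreover the variables of $\mathcal C'$ are among the first $r m'$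 variables. -/

import Mathlib

namespace ExactSat

/-! ### Formulas -/

/-- A literal over the variables `x_0, x_1, x_2, …`: the pair `(i, true)` is `x_i`
and the pair `(i, false)` is its negation `-x_i`. -/
abbrev Literal := ℕ × Bool

/-- The complementary literal `-p`. -/
def Literal.neg (p : Literal) : Literal := (p.1, !p.2)

/-- A clause is a finite set of literals. -/
abbrev Clause := Finset Literal

/-- A CNF formula is a finite set of clauses. -/
abbrev Formula := Finset Clause

/-- Every clause consists of exactly `r` distinct literals, no two of them complementary. -/
def IsExactCNF (r : ℕ) (C : Formula) : Prop :=
  ∀ Y ∈ C, Y.card = r ∧ ∀ p ∈ Y, p.neg ∉ Y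

/-- `Y` contains a literal whose negation is in `Z`. -/
def Conflict (Y Z : Clause) : Prop := ∃ p ∈ Y, p.neg ∈ Z

/-- `Y` and `Z` have a common literal, but no conflict. -/
def Overlap (Y Z : Clause) : Prop := (∃ p ∈ Y, p ∈ Z) ∧ ¬ Conflict Y Z

open Classical in
/-- The number of ordered pairs of distinct clauses having a conflict minus the number of
ordered pairs of distinct clauses having an overlap. -/
noncomputable def conflictNumber (C : Formula) : ℤ :=
  ((C.offDiag.filter fun P => Conflict P.1 P.2).card : ℤ)
    - ((C.offDiag.filter fun P => Overlap P.1 P.2).card : ℤ)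

/-- The truth assignment `τ` makes some literal of `Y` true. -/
def Satisfies (τ : ℕ → Bool) (Y : Clause) : Prop := ∃ p ∈ Y, τ p.1 = p.2

open Classical in
/-- The number of clauses of `C` satisfied by `τ`. -/
noncomputable def numSatisfied (τ : ℕ → Bool) (C : Formula) : ℕ :=
  (C.filter fun Y => Satisfies τ Y).card

/-! ### Instances and their encoding as words -/

/-- An instance of Exact `r`-SAT above the tight lower bound, as it is written down: an exact
`r`-CNF formula, given by a list of its clauses (each of them given by a list of its literals,
both lists without repetition), and a positive rational number `k = num / 2 ^ r`, given by its
numerator. -/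
structure SatInstance (r : ℕ) where
  clauses : List (List Literal)
  num : ℕ
  literals_nodup : ∀ c ∈ clauses, c.Nodup
  clauses_nodup : (clauses.map List.toFinset).Nodup
  isExactCNF : IsExactCNF r (clauses.map List.toFinset).toFinset
  num_pos : 0 < num

/-- The formula of an instance. -/
def SatInstance.formula {r : ℕ} (I : SatInstance r) : Formula :=
  (I.clauses.map List.toFinset).toFinset

/-- The parameter of an instance. -/
def SatInstance.k {r : ℕ} (I : SatInstance r) : ℚ := (I.num : ℚ) / 2 ^ r

/-- Some truth assignment satisfies at least `(1 - 2⁻ʳ) m + k` clauses. -/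
def SatInstance.IsYes {r : ℕ} (I : SatInstance r) : Prop :=
  ∃ τ : ℕ → Bool,
    (1 - 1 / 2 ^ r) * (I.formula.card : ℚ) + I.k ≤ (numSatisfied τ I.formula : ℚ)

/-- The alphabet in which instances are written: binary digits, a sign that opens a literal,
and a mark that opens a clause. -/
inductive Sym where
  | bit (b : Bool)
  | sign (b : Bool)
  | clause
  deriving DecidableEq, Fintype

/-- A natural number in binary, without superfluous digits. -/
def encodeNumber (n : ℕ) : List Sym := (Computability.encodeNat n).map Sym.bit

/-- A literal: its sign, followed by the index of its variable in binary. -/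
def encodeLiteral (p : Literal) : List Sym := Sym.sign p.2 :: encodeNumber p.1

/-- A clause: the mark, followed by its literals. -/
def encodeClause (c : List Literal) : List Sym := Sym.clause :: c.flatMap encodeLiteral

/-- An instance: the numerator of `k` in binary, followed by the clauses. -/
def SatInstance.encode {r : ℕ} (I : SatInstance r) : List Sym :=
  encodeNumber I.num ++ I.clauses.flatMap encodeClause

theorem encodeNumber_append_inj {m n : ℕ} {s t : List Sym}
    (hs : ∀ b u, s ≠ Sym.bit b :: u) (ht : ∀ b u, t ≠ Sym.bit b :: u)
    (h : encodeNumber m ++ s = encodeNumber n ++ t) : m = n ∧ s = t := by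
  have key : ∀ l l' : List Bool, l.map Sym.bit ++ s = l'.map Sym.bit ++ t → l = l' ∧ s = t := by
    intro l
    induction l with
    | nil =>
      intro l' h
      cases l' with
      | nil => exact ⟨rfl, by simpa using h⟩
      | cons b l' => exact absurd (by simpa using h) (hs b (l'.map Sym.bit ++ t))
    | cons a l ih =>
      intro l' h
      cases l' with
      | nil => exact absurd (by simpa using h.symm) (ht a (l.map Sym.bit ++ s))
      | cons b l' =>
        simp only [List.map_cons, List.cons_append, List.cons.injEq, Sym.bit.injEq] at h
        obtain ⟨h1, h2⟩ := ih l' h.2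
        exact ⟨by rw [h.1, h1], h2⟩
  obtain ⟨h1, h2⟩ := key _ _ h
  refine ⟨?_, h2⟩
  rw [← Computability.decode_encodeNat m, h1, Computability.decode_encodeNat]

theorem encodeLiterals_append_inj {s t : List Sym}
    (hs : s = [] ∨ ∃ u, s = Sym.clause :: u) (ht : t = [] ∨ ∃ u, t = Sym.clause :: u) :
    ∀ c d : List Literal, c.flatMap encodeLiteral ++ s = d.flatMap encodeLiteral ++ t →
      c = d ∧ s = t := by
  have nobit : ∀ (c : List Literal) (s : List Sym), (s = [] ∨ ∃ u, s = Sym.clause :: u) →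
      ∀ b u, c.flatMap encodeLiteral ++ s ≠ Sym.bit b :: u := by
    intro c s hs b u
    cases c with
    | nil => rcases hs with rfl | ⟨v, rfl⟩ <;> simp
    | cons p c => simp [encodeLiteral]
  intro c
  induction c with
  | nil =>
    intro d h
    cases d with
    | nil => exact ⟨rfl, by simpa using h⟩
    | cons q d => rcases hs with rfl | ⟨u, rfl⟩ <;> simp [encodeLiteral] at h
  | cons p c ih =>
    intro d h
    cases d with
    | nil => rcases ht with rfl | ⟨u, rfl⟩ <;> simp [encodeLiteral] at h
    | cons q d =>
      simp only [List.flatMap_cons, encodeLiteral, List.cons_append, List.append_assoc,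
        List.cons.injEq, Sym.sign.injEq] at h
      obtain ⟨h1, h2⟩ := encodeNumber_append_inj (nobit c s hs) (nobit d t ht) h.2
      obtain ⟨h3, h4⟩ := ih d h2
      exact ⟨by rw [h3, Prod.ext h1 h.1], h4⟩

theorem encodeClauses_shape (L : List (List Literal)) :
    L.flatMap encodeClause = [] ∨ ∃ u, L.flatMap encodeClause = Sym.clause :: u := by
  cases L with
  | nil => exact Or.inl rfl
  | cons c L => exact Or.inr ⟨_, rfl⟩

theorem encodeClauses_injective :
    ∀ L M : List (List Literal), L.flatMap encodeClause = M.flatMap encodeClause → L = M := by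
  intro L
  induction L with
  | nil =>
    intro M h
    cases M with
    | nil => rfl
    | cons d M => simp [encodeClause] at h
  | cons c L ih =>
    intro M h
    cases M with
    | nil => simp [encodeClause] at h
    | cons d M =>
      simp only [List.flatMap_cons, encodeClause, List.cons_append, List.cons.injEq,
        true_and] at h
      obtain ⟨h1, h2⟩ :=
        encodeLiterals_append_inj (encodeClauses_shape L) (encodeClauses_shape M) c d h
      rw [h1, ih M h2]

/-- Distinct instances are written differently. -/
theorem SatInstance.encode_injective {r : ℕ} :
    Function.Injective (SatInstance.encode : SatInstance r → List Sym) := by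
  have nobit : ∀ (L : List (List Literal)) b u, L.flatMap encodeClause ≠ Sym.bit b :: u := by
    intro L b u
    rcases encodeClauses_shape L with h | ⟨v, h⟩ <;> rw [h] <;> simp
  rintro ⟨L, m, _, _, _, _⟩ ⟨M, n, _, _, _, _⟩ h
  obtain ⟨h1, h2⟩ := encodeNumber_append_inj (nobit L) (nobit M) h
  have h3 : L = M := encodeClauses_injective L M h2
  obtain rfl : m = n := h1
  subst h3
  rfl

/-! ### Parameterized problems and kernelizations -/

/-- A parameterized decision problem: a type of instances, written as words over a finite
alphabet, with a parameter and a set of yes-instances. -/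
structure ParameterizedProblem where
  Inst : Type
  Alphabet : Type
  finite_alphabet : Finite Alphabet
  encode : Inst → List Alphabet
  encode_injective : Function.Injective encode
  param : Inst → ℚ
  IsYes : Inst → Prop

/-- The problem restricted to the instances that satisfy `S`. -/
def ParameterizedProblem.restrict (P : ParameterizedProblem) (S : P.Inst → Prop) :
    ParameterizedProblem where
  Inst := {I : P.Inst // S I}
  Alphabet := P.Alphabet
  finite_alphabet := P.finite_alphabet
  encode I := P.encode I.1
  encode_injective := P.encode_injective.comp Subtype.val_injective
  param I := P.param I.1
  IsYes I := P.IsYes I.1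

/-- A kernelization maps, in polynomial time on a Turing machine, each instance to an instance of
the same problem with the same answer, whose parameter is not larger than that of the given
instance and whose size is bounded by a function of the parameter of the given instance. -/
structure ParameterizedProblem.IsKernelization (P : ParameterizedProblem)
    (f : P.Inst → P.Inst) : Prop where
  polyTime : Nonempty (Turing.TM2ComputableInPolyTime P.encode P.encode f)
  equivalent : ∀ I, P.IsYes (f I) ↔ P.IsYes I
  param_le : ∀ I, P.param (f I) ≤ P.param I
  size_le : ∃ g : ℚ → ℕ, ∀ I, (P.encode (f I)).length ≤ g (P.param I)

/-- Exact `r`-SAT above the tight lower bound `(1 - 2⁻ʳ) m`. -/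
def satAboveTightLowerBound (r : ℕ) : ParameterizedProblem where
  Inst := SatInstance r
  Alphabet := Sym
  finite_alphabet := inferInstance
  encode := SatInstance.encode
  encode_injective := SatInstance.encode_injective
  param := SatInstance.k
  IsYes := SatInstance.IsYes

/-- The conflict number of the formula is at most `(2 ^ r - 2) m`. -/
def LowConflict (r : ℕ) (I : SatInstance r) : Prop :=
  conflictNumber I.formula ≤ (2 ^ r - 2) * (I.formula.card : ℤ)

/-- Exact `r`-SAT above the tight lower bound, restricted to formulas of conflict number at most
`(2 ^ r - 2) m`. -/
def lowConflictSat (r : ℕ) : ParameterizedProblem :=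
  (satAboveTightLowerBound r).restrict (LowConflict r)

/-- The formula of an instance of the restricted problem. -/
def lowConflictSat.formula {r : ℕ} (I : (lowConflictSat r).Inst) : Formula :=
  SatInstance.formula I.1

end ExactSat

/-!
# A quadratic kernel for Exact `r`-SAT above the tight lower bound

**Many clauses force the answer yes.** Under a uniform random assignment let `X` be the number of
satisfied clauses minus its mean `(1 - 2⁻ʳ) m`. Two clauses are falsified simultaneously with
probability `0` if they conflict, at least `2 ^ (1 - 2 r)` if they overlap, and `4⁻ʳ` otherwise, so
that `E X² ≥ 4⁻ʳ ((2 ^ r - 1) m - cn) ≥ 4⁻ʳ m` (`card_le_expect_excess_sq`). As a polynomial in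
`±1`-valued variables `X` has degree at most `r`, and Bonami's lemma gives `E X⁴ ≤ 9 ^ r (E X²)²`
(`expect_sq_mul_sq_le`). A centred variable with these moments has a value of the order
`3⁻ʳ (E X²)^(1/2)` (`expect_sq_le_of_le`), whence the answer is yes as soon as
`m ≥ 4 * 16 ^ r * num ^ 2`, where `k = num / 2 ^ r` (`exists_numSatisfied_ge`).

**The kernel.** Let `2 ^ t` be the power of two with `t = 4 r + 2 + 2 * (number of digits of num)`;
it lies between `4 * 16 ^ r * num ^ 2` and `16 * 16 ^ r * num ^ 2` (`two_pow_threshold_bounds`). If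
there are at least `2 ^ t` clauses, the kernel is a fixed yes-instance with one clause. Otherwise
each variable is replaced by the position of its first occurrence among the `r m` literals, which
is an injective renaming and so changes neither the answer nor the conflict number.

**Polynomial time.** The map is computed by an explicit machine with nine stacks (`program`). It
counts clauses on a binary counter with exactly `t` digits, whose overflow is the event
`m ≥ 2 ^ t`. To rename a variable it searches the literals read so far from the newest to the
oldest, with a second counter that is set to zero at each occurrence of the variable and is
increased at each other literal; in the end that counter holds the number of literals before the
first occurrence (`scan_eq_idxOf`). Each symbol of the input costs quadratic time, so the running
time is cubic (`reach_halted`).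
-/

namespace ExactSat

open Computability (encodeNat encodeNum encodePosNum)

/-! ### Averages over truth assignments -/

/-- The average of `f` over the two values of the variable `i`. -/
noncomputable def avgVar (i : ℕ) (f : (ℕ → Bool) → ℝ) : (ℕ → Bool) → ℝ := fun τ =>
  (f (Function.update τ i true) + f (Function.update τ i false)) / 2

/-- Half the difference of `f` between the two values of the variable `i`: with the values
`true`, `false` read as `1`, `-1`, the coefficient of `x_i` in `f`. -/
noncomputable def halfDiff (i : ℕ) (f : (ℕ → Bool) → ℝ) : (ℕ → Bool) → ℝ := fun τ =>
  (f (Function.update τ i true) - f (Function.update τ i false)) / 2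

/-- The expectation of `f` when the variables in `l` take independent uniform random values and
all others are `false`. -/
noncomputable def expect : List ℕ → ((ℕ → Bool) → ℝ) → ℝ
  | [], f => f fun _ => false
  | i :: l, f => expect l (avgVar i f)

theorem expect_add (l : List ℕ) (f g : (ℕ → Bool) → ℝ) :
    expect l (fun τ => f τ + g τ) = expect l f + expect l g := by
  induction l generalizing f g with
  | nil => rfl
  | cons i l ih =>
    simp only [expect]
    rw [← ih]
    congr 1
    funext τ
    simp only [avgVar]
    ring

theorem expect_const_mul (l : List ℕ) (c : ℝ) (f : (ℕ → Bool) → ℝ) :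
    expect l (fun τ => c * f τ) = c * expect l f := by
  induction l generalizing f with
  | nil => rfl
  | cons i l ih =>
    simp only [expect]
    rw [← ih]
    congr 1
    funext τ
    simp only [avgVar]
    ring

theorem expect_const (l : List ℕ) (c : ℝ) : expect l (fun _ => c) = c := by
  induction l with
  | nil => rfl
  | cons i l ih =>
    rw [expect]
    convert ih using 2
    funext τ
    simp [avgVar]

theorem expect_mono (l : List ℕ) {f g : (ℕ → Bool) → ℝ} (h : ∀ τ, f τ ≤ g τ) :
    expect l f ≤ expect l g := by
  induction l generalizing f g with
  | nil => exact h _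
  | cons i l ih =>
    refine ih fun τ => ?_
    simp only [avgVar]
    linarith [h (Function.update τ i true), h (Function.update τ i false)]

theorem expect_nonneg (l : List ℕ) {f : (ℕ → Bool) → ℝ} (h : ∀ τ, 0 ≤ f τ) : 0 ≤ expect l f := by
  simpa only [expect_const] using expect_mono l h

theorem expect_sum {ι : Type*} (l : List ℕ) (s : Finset ι) (f : ι → (ℕ → Bool) → ℝ) :
    expect l (fun τ => ∑ j ∈ s, f j τ) = ∑ j ∈ s, expect l (f j) := by
  classical
  induction s using Finset.induction_on with
  | empty => simpa using expect_const l 0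
  | insert a s ha ih => simp only [Finset.sum_insert ha, expect_add, ih]

/-! ### Functions of low degree -/

/-- `DegLE l d f`: as a multilinear polynomial in the `±1`-valued variables of `l`, the function
`f` has degree at most `d`. -/
def DegLE : List ℕ → ℕ → ((ℕ → Bool) → ℝ) → Prop
  | [], _, _ => True
  | i :: l, 0, f => (∀ τ, halfDiff i f τ = 0) ∧ DegLE l 0 (avgVar i f)
  | i :: l, d + 1, f => DegLE l d (halfDiff i f) ∧ DegLE l (d + 1) (avgVar i f)

theorem DegLE.add {l : List ℕ} {d : ℕ} {f g : (ℕ → Bool) → ℝ} (hf : DegLE l d f)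
    (hg : DegLE l d g) : DegLE l d (fun τ => f τ + g τ) := by
  induction l generalizing d f g with
  | nil => trivial
  | cons i l ih =>
    have h1 : avgVar i (fun τ => f τ + g τ) = fun τ => avgVar i f τ + avgVar i g τ := by
      funext τ
      simp only [avgVar]
      ring
    have h2 : halfDiff i (fun τ => f τ + g τ) = fun τ => halfDiff i f τ + halfDiff i g τ := by
      funext τ
      simp only [halfDiff]
      ring
    cases d with
    | zero =>
      refine ⟨fun τ => ?_, ?_⟩
      · simp [h2, hf.1 τ, hg.1 τ]
      · rw [h1]
        exact ih hf.2 hg.2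
    | succ d =>
      refine ⟨?_, ?_⟩
      · rw [h2]
        exact ih hf.1 hg.1
      · rw [h1]
        exact ih hf.2 hg.2

theorem update_eq_of_dependsOn {i : ℕ} {f : (ℕ → Bool) → ℝ} {S : Finset ℕ} (h : DependsOn f S)
    {x y : ℕ → Bool} (hxy : ∀ j ∈ ((S.erase i : Finset ℕ) : Set ℕ), x j = y j) (b : Bool) :
    f (Function.update x i b) = f (Function.update y i b) := by
  refine h fun j hj => ?_
  by_cases hji : j = i
  · subst hji
    simp
  · simpa [hji] using hxy j (by simpa [hji] using hj)

theorem avgVar_dependsOn {i : ℕ} {f : (ℕ → Bool) → ℝ} {S : Finset ℕ} (h : DependsOn f S) :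
    DependsOn (avgVar i f) (S.erase i : Finset ℕ) := by
  intro x y hxy
  simp only [avgVar, update_eq_of_dependsOn h hxy]

theorem halfDiff_dependsOn {i : ℕ} {f : (ℕ → Bool) → ℝ} {S : Finset ℕ} (h : DependsOn f S) :
    DependsOn (halfDiff i f) (S.erase i : Finset ℕ) := by
  intro x y hxy
  simp only [halfDiff, update_eq_of_dependsOn h hxy]

theorem halfDiff_eq_zero {i : ℕ} {f : (ℕ → Bool) → ℝ} {S : Finset ℕ} (h : DependsOn f S)
    (hi : i ∉ S) (τ : ℕ → Bool) : halfDiff i f τ = 0 := by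
  have : f (Function.update τ i true) = f (Function.update τ i false) := by
    refine h fun j hj => ?_
    have hji : j ≠ i := fun e => hi (e ▸ hj)
    simp [hji]
  simp [halfDiff, this]

/-- A function of at most `d` variables has degree at most `d`. -/
theorem degLE_of_dependsOn (l : List ℕ) {d : ℕ} {f : (ℕ → Bool) → ℝ} {S : Finset ℕ}
    (h : DependsOn f S) (hS : S.card ≤ d) : DegLE l d f := by
  induction l generalizing d f S with
  | nil => trivial
  | cons i l ih =>
    have hav : ((S.erase i).card ≤ d) := (Finset.card_erase_le).trans hS
    cases d with
    | zero =>
      refine ⟨halfDiff_eq_zero h ?_, ih (avgVar_dependsOn h) hav⟩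
      rw [Nat.le_zero, Finset.card_eq_zero] at hS
      simp [hS]
    | succ d =>
      refine ⟨?_, ih (avgVar_dependsOn h) hav⟩
      by_cases hi : i ∈ S
      · refine ih (halfDiff_dependsOn h) ?_
        rw [Finset.card_erase_of_mem hi]
        omega
      · refine ih (S := ∅) ?_ (by simp)
        intro x y _
        rw [halfDiff_eq_zero h hi, halfDiff_eq_zero h hi]

theorem degLE_sum {ι : Type*} (l : List ℕ) (d : ℕ) (s : Finset ι) (f : ι → (ℕ → Bool) → ℝ)
    (h : ∀ j ∈ s, DegLE l d (f j)) : DegLE l d (fun τ => ∑ j ∈ s, f j τ) := by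
  classical
  induction s using Finset.induction_on with
  | empty => exact degLE_of_dependsOn l (S := ∅) (fun x y _ => by simp) (by simp)
  | insert a s ha ih =>
    simp only [Finset.sum_insert ha]
    exact (h a (by simp)).add (ih fun j hj => h j (by simp [hj]))

/-- Bonami's lemma, in a bilinear form that makes the induction on the variables go through
without the Cauchy-Schwarz inequality. -/
theorem expect_sq_mul_sq_le (l : List ℕ) {d e : ℕ} {f g : (ℕ → Bool) → ℝ} (hf : DegLE l d f)
    (hg : DegLE l e g) :
    expect l (fun τ => f τ ^ 2 * g τ ^ 2)
      ≤ 3 ^ (d + e) * (expect l (fun τ => f τ ^ 2) * expect l (fun τ => g τ ^ 2)) := by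
  induction l generalizing d e f g with
  | nil =>
    simp only [expect]
    exact le_mul_of_one_le_left (by positivity) (one_le_pow₀ (by norm_num))
  | cons i l ih =>
    set a := avgVar i f with ha
    set b := avgVar i g with hb
    set p := halfDiff i f with hp
    set q := halfDiff i g with hq
    have sq : ∀ u : (ℕ → Bool) → ℝ, expect (i :: l) (fun τ => u τ ^ 2)
        = expect l (fun τ => avgVar i u τ ^ 2) + expect l (fun τ => halfDiff i u τ ^ 2) := by
      intro u
      rw [← expect_add, expect]
      congr 1
      funext τ
      simp only [avgVar, halfDiff]
      ring
    -- With `f = a ± p` and `g = b ± q` only the mixed term `4 a p b q` is not a product of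
    -- squares, and it is at most `2 a² q² + 2 p² b²`.
    have h0 : expect (i :: l) (fun τ => f τ ^ 2 * g τ ^ 2)
        ≤ expect l (fun τ => a τ ^ 2 * b τ ^ 2) + 3 * expect l (fun τ => a τ ^ 2 * q τ ^ 2)
          + 3 * expect l (fun τ => p τ ^ 2 * b τ ^ 2) + expect l (fun τ => p τ ^ 2 * q τ ^ 2) := by
      rw [← expect_const_mul, ← expect_const_mul, ← expect_add, ← expect_add, ← expect_add]
      refine expect_mono l fun τ => ?_
      have e1 : avgVar i (fun τ => f τ ^ 2 * g τ ^ 2) τ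
          = a τ ^ 2 * b τ ^ 2 + a τ ^ 2 * q τ ^ 2 + p τ ^ 2 * b τ ^ 2 + p τ ^ 2 * q τ ^ 2
            + 4 * (a τ * q τ) * (p τ * b τ) := by
        simp only [ha, hb, hp, hq, avgVar, halfDiff]
        ring
      rw [e1]
      nlinarith [sq_nonneg (a τ * q τ - p τ * b τ)]
    have ha' : DegLE l d a := by cases d <;> exact hf.2
    have hb' : DegLE l e b := by cases e <;> exact hg.2
    have zero_sq : ∀ u : (ℕ → Bool) → ℝ, (∀ τ, u τ = 0) → expect l (fun τ => u τ ^ 2) = 0 := by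
      intro u hu
      simpa [hu] using expect_const l 0
    have n1 : (0 : ℝ) ≤ expect l fun τ => a τ ^ 2 := expect_nonneg l fun τ => by positivity
    have n2 : (0 : ℝ) ≤ expect l fun τ => b τ ^ 2 := expect_nonneg l fun τ => by positivity
    have n3 : (0 : ℝ) ≤ expect l fun τ => p τ ^ 2 := expect_nonneg l fun τ => by positivity
    have n4 : (0 : ℝ) ≤ expect l fun τ => q τ ^ 2 := expect_nonneg l fun τ => by positivity
    have h1 := ih ha' hb'
    have h2 : 3 * expect l (fun τ => a τ ^ 2 * q τ ^ 2)
        ≤ 3 ^ (d + e) * (expect l (fun τ => a τ ^ 2) * expect l (fun τ => q τ ^ 2)) := by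
      cases e with
      | zero =>
        have : expect l (fun τ => a τ ^ 2 * q τ ^ 2) = 0 := by
          simpa [show ∀ τ, q τ = 0 from hg.1] using expect_const l 0
        rw [this, mul_zero]
        positivity
      | succ e =>
        have := ih ha' hg.1
        rw [← add_assoc, pow_succ]
        linarith
    have h3 : 3 * expect l (fun τ => p τ ^ 2 * b τ ^ 2)
        ≤ 3 ^ (d + e) * (expect l (fun τ => p τ ^ 2) * expect l (fun τ => b τ ^ 2)) := by
      cases d with
      | zero =>
        have : expect l (fun τ => p τ ^ 2 * b τ ^ 2) = 0 := by
          simpa [show ∀ τ, p τ = 0 from hf.1] using expect_const l 0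
        rw [this, mul_zero]
        positivity
      | succ d =>
        have := ih hf.1 hb'
        rw [add_right_comm, pow_succ]
        linarith
    have h4 : expect l (fun τ => p τ ^ 2 * q τ ^ 2)
        ≤ 3 ^ (d + e) * (expect l (fun τ => p τ ^ 2) * expect l (fun τ => q τ ^ 2)) := by
      cases d with
      | zero =>
        have : expect l (fun τ => p τ ^ 2 * q τ ^ 2) = 0 := by
          simpa [show ∀ τ, p τ = 0 from hf.1] using expect_const l 0
        rw [this]
        positivity
      | succ d =>
        cases e with
        | zero =>
          have : expect l (fun τ => p τ ^ 2 * q τ ^ 2) = 0 := by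
            simpa [show ∀ τ, q τ = 0 from hg.1] using expect_const l 0
          rw [this]
          positivity
        | succ e =>
          refine (ih hf.1 hg.1).trans (mul_le_mul_of_nonneg_right ?_ (by positivity))
          exact pow_le_pow_right₀ (by norm_num) (by omega)
    rw [sq f, sq g]
    linarith

/-- The fourth moment method: a centred function of degree at most `d` cannot stay below a small
multiple of its standard deviation. -/
theorem expect_sq_le_of_le (l : List ℕ) {d : ℕ} {f : (ℕ → Bool) → ℝ} (hf : DegLE l d f)
    (h0 : expect l f = 0) {k : ℝ} (hk : 0 ≤ k) (hfk : ∀ τ, f τ ≤ k) :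
    expect l (fun τ => f τ ^ 2) ≤ 4 * 9 ^ d * k ^ 2 := by
  set s := expect l (fun τ => f τ ^ 2) with hs
  have s0 : 0 ≤ s := expect_nonneg l fun τ => by positivity
  have h4 : expect l (fun τ => f τ ^ 4) ≤ 9 ^ d * s ^ 2 := by
    have := expect_sq_mul_sq_le l hf hf
    rw [← two_mul d, pow_mul] at this
    norm_num at this
    calc expect l (fun τ => f τ ^ 4) = expect l (fun τ => f τ ^ 2 * f τ ^ 2) := by
          congr 1
          funext τ
          ring
      _ ≤ _ := by rw [sq s]; exact this
  have habs : expect l (fun τ => |f τ|) ≤ 2 * k := by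
    have : expect l (fun τ => |f τ|) ≤ expect l (fun τ => 2 * k + (-1) * f τ) :=
      expect_mono l fun τ => by
        have := hfk τ
        rcases abs_cases (f τ) with h | h <;> linarith
    rw [expect_add, expect_const, expect_const_mul, h0] at this
    linarith
  -- The pointwise inequality `3 α² u² ≤ 2 α³ |u| + u⁴`, for the optimal `α = 3 ^ d * √s`.
  set α := 3 ^ d * Real.sqrt s with hα
  have α0 : 0 ≤ α := by positivity
  have hα2 : α ^ 2 = 9 ^ d * s := by
    rw [hα, mul_pow, Real.sq_sqrt s0, ← pow_mul, mul_comm d, pow_mul]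
    norm_num
  have hpt : 3 * α ^ 2 * s ≤ 2 * α ^ 3 * expect l (fun τ => |f τ|) + expect l (fun τ => f τ ^ 4) := by
    rw [hs, ← expect_const_mul, ← expect_const_mul, ← expect_add]
    refine expect_mono l fun τ => ?_
    have e2 : f τ ^ 2 = |f τ| ^ 2 := (sq_abs _).symm
    have e4 : f τ ^ 4 = |f τ| ^ 4 := by
      rw [show (4 : ℕ) = 2 * 2 from rfl, pow_mul, pow_mul, e2]
    rw [e2, e4]
    have u0 := abs_nonneg (f τ)
    generalize |f τ| = u at *
    have : 0 ≤ u * ((u - α) ^ 2 * (u + 2 * α)) := by positivity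
    nlinarith
  rcases s0.eq_or_lt with h | hpos
  · rw [← h]
    positivity
  have αpos : 0 < α := by positivity
  have h5 : 2 * α ^ 2 * s ≤ 4 * α ^ 3 * k := by
    have : 2 * α ^ 3 * expect l (fun τ => |f τ|) ≤ 2 * α ^ 3 * (2 * k) :=
      mul_le_mul_of_nonneg_left habs (by positivity)
    have h6 : 9 ^ d * s ^ 2 = α ^ 2 * s := by rw [hα2]; ring
    linarith
  have h7 : s ≤ 2 * α * k := by
    have : α ^ 2 * s ≤ α ^ 2 * (2 * α * k) := by linarith
    exact le_of_mul_le_mul_left this (by positivity)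
  have h8 : s * s ≤ s * (4 * 9 ^ d * k ^ 2) := by
    calc s * s ≤ (2 * α * k) * (2 * α * k) := mul_le_mul h7 h7 s0 (by positivity)
      _ = 4 * α ^ 2 * k ^ 2 := by ring
      _ = s * (4 * 9 ^ d * k ^ 2) := by rw [hα2]; ring
  exact le_of_mul_le_mul_left h8 hpos

/-! ### Random assignments and the conflict number -/

open Classical in
/-- The indicator of the assignments that falsify all literals of `Y`. -/
noncomputable def falsified (Y : Clause) (τ : ℕ → Bool) : ℝ := if Satisfies τ Y then 0 else 1

theorem satisfies_congr {Y : Clause} {τ τ' : ℕ → Bool} (h : ∀ p ∈ Y, τ p.1 = τ' p.1) :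
    Satisfies τ Y ↔ Satisfies τ' Y := by
  constructor <;> rintro ⟨p, hp, e⟩
  · exact ⟨p, hp, by rw [← h p hp, e]⟩
  · exact ⟨p, hp, by rw [h p hp, e]⟩

theorem falsified_congr {Y Z : Clause} {τ τ' : ℕ → Bool} (h : Satisfies τ Y ↔ Satisfies τ' Z) :
    falsified Y τ = falsified Z τ' := by
  by_cases h1 : Satisfies τ' Z
  · simp [falsified, h1, h.2 h1]
  · simp [falsified, h1, mt h.1 h1]

theorem falsified_dependsOn (Y : Clause) :
    DependsOn (falsified Y) (Y.image Prod.fst : Finset ℕ) := by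
  intro x y hxy
  refine falsified_congr (satisfies_congr fun p hp => hxy p.1 ?_)
  rw [Finset.mem_coe]
  exact Finset.mem_image_of_mem _ hp

theorem falsified_mul (Y Z : Clause) (τ : ℕ → Bool) :
    falsified Y τ * falsified Z τ = falsified (Y ∪ Z) τ := by
  have : Satisfies τ (Y ∪ Z) ↔ Satisfies τ Y ∨ Satisfies τ Z := by
    simp only [Satisfies, Finset.mem_union, or_and_right, exists_or]
  by_cases h1 : Satisfies τ Y <;> by_cases h2 : Satisfies τ Z <;> simp [falsified, this, h1, h2]

theorem Literal.eq_or_eq_neg {p q : Literal} (h : p.1 = q.1) : p = q ∨ p = q.neg := by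
  obtain ⟨i, b⟩ := p
  obtain ⟨j, c⟩ := q
  obtain rfl : i = j := h
  cases b <;> cases c <;> simp [Literal.neg]

theorem avgVar_falsified_of_mem {Y : Clause} (hY : ∀ p ∈ Y, p.neg ∉ Y) {p : Literal} (hp : p ∈ Y)
    (τ : ℕ → Bool) : avgVar p.1 (falsified Y) τ = 1 / 2 * falsified (Y.erase p) τ := by
  obtain ⟨i, b⟩ := p
  have hsame : ∀ q ∈ Y.erase (i, b), q.1 ≠ i := by
    intro q hq e
    rcases Literal.eq_or_eq_neg (p := q) (q := (i, b)) e with h | h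
    · exact Finset.ne_of_mem_erase hq h
    · exact hY _ hp (h ▸ Finset.mem_of_mem_erase hq)
  have hT : falsified Y (Function.update τ i b) = 0 := if_pos ⟨_, hp, by simp⟩
  have hF : falsified Y (Function.update τ i (!b)) = falsified (Y.erase (i, b)) τ := by
    apply falsified_congr
    have h1 : Satisfies (Function.update τ i (!b)) Y
        ↔ Satisfies (Function.update τ i (!b)) (Y.erase (i, b)) := by
      constructor
      · rintro ⟨q, hq, e⟩
        refine ⟨q, Finset.mem_erase.2 ⟨?_, hq⟩, e⟩
        rintro rfl
        simp at e
      · rintro ⟨q, hq, e⟩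
        exact ⟨q, Finset.mem_of_mem_erase hq, e⟩
    rw [h1]
    exact satisfies_congr fun q hq => by simp [hsame q hq]
  cases b <;> simp only [Bool.not_true, Bool.not_false] at hF <;>
    rw [avgVar, hT, hF] <;> ring

theorem avgVar_falsified_of_notMem {Y : Clause} {i : ℕ} (h : ∀ p ∈ Y, p.1 ≠ i) (τ : ℕ → Bool) :
    avgVar i (falsified Y) τ = falsified Y τ := by
  have : ∀ b, falsified Y (Function.update τ i b) = falsified Y τ := fun b =>
    falsified_congr (satisfies_congr fun p hp => by simp [h p hp])
  simp only [avgVar, this]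
  ring

/-- A set of literals without complementary pairs is falsified with probability `2 ^ (-|Y|)`. -/
theorem expect_falsified (l : List ℕ) (Y : Clause) (hY : ∀ p ∈ Y, p.neg ∉ Y)
    (hl : ∀ p ∈ Y, p.1 ∈ l) : expect l (falsified Y) = (1 / 2) ^ Y.card := by
  induction l generalizing Y with
  | nil =>
    obtain rfl : Y = ∅ := Finset.eq_empty_of_forall_notMem fun p hp => by simpa using hl p hp
    simp [expect, falsified, Satisfies]
  | cons i l ih =>
    rw [expect]
    by_cases h : ∃ p ∈ Y, p.1 = i
    · obtain ⟨p, hp, rfl⟩ := h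
      rw [funext (avgVar_falsified_of_mem hY hp), expect_const_mul, ih, ← pow_succ',
        Finset.card_erase_add_one hp]
      · exact fun q hq hn => hY q (Finset.mem_of_mem_erase hq) (Finset.mem_of_mem_erase hn)
      · intro q hq
        have hq' := Finset.mem_of_mem_erase hq
        rcases List.mem_cons.1 (hl q hq') with e | e
        · rcases Literal.eq_or_eq_neg e with h | h
          · exact absurd h (Finset.ne_of_mem_erase hq)
          · exact absurd (h ▸ hq') (hY p hp)
        · exact e
    · push Not at h
      rw [funext (avgVar_falsified_of_notMem h)]
      exact ih Y hY fun p hp => (List.mem_cons.1 (hl p hp)).resolve_left (h p hp)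

/-- If two clauses conflict, then every assignment satisfies one of them. -/
theorem falsified_mul_of_conflict {Y Z : Clause} (h : Conflict Y Z) (τ : ℕ → Bool) :
    falsified Y τ * falsified Z τ = 0 := by
  obtain ⟨p, hp, hn⟩ := h
  by_cases hs : Satisfies τ Y
  · simp [falsified, hs]
  · have : Satisfies τ Z := ⟨_, hn, by
      have : τ p.1 ≠ p.2 := fun e => hs ⟨p, hp, e⟩
      simp only [Literal.neg]
      revert this
      cases τ p.1 <;> cases p.2 <;> simp⟩
    simp [falsified, this]

open Classical in
/-- The covariance of the events that two clauses are falsified, from below: a conflict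
contributes negatively, an overlap positively. -/
theorem covariance_lower_bound {r : ℕ} {l : List ℕ} {Y Z : Clause} (hY : Y.card = r)
    (hY' : ∀ p ∈ Y, p.neg ∉ Y) (hZ : Z.card = r) (hZ' : ∀ p ∈ Z, p.neg ∉ Z)
    (hYl : ∀ p ∈ Y, p.1 ∈ l) (hZl : ∀ p ∈ Z, p.1 ∈ l) :
    (1 / 4 : ℝ) ^ r * ((if Overlap Y Z then 1 else 0) - (if Conflict Y Z then 1 else 0))
      ≤ expect l (fun τ => falsified Y τ * falsified Z τ) - (1 / 4) ^ r := by
  have h4 : (1 / 4 : ℝ) ^ r = (1 / 2) ^ (r + r) := by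
    rw [← two_mul, pow_mul]
    norm_num
  by_cases hc : Conflict Y Z
  · have : ¬ Overlap Y Z := fun h => h.2 hc
    rw [funext (falsified_mul_of_conflict hc), expect_const]
    simp [hc, this]
  · have hU : ∀ p ∈ Y ∪ Z, p.neg ∉ Y ∪ Z := by
      intro p hp hn
      rcases Finset.mem_union.1 hp with h1 | h1 <;> rcases Finset.mem_union.1 hn with h2 | h2
      · exact hY' p h1 h2
      · exact hc ⟨p, h1, h2⟩
      · exact hc ⟨_, h2, by simpa [Literal.neg] using h1⟩
      · exact hZ' p h1 h2
    have hE : expect l (fun τ => falsified Y τ * falsified Z τ) = (1 / 2) ^ (Y ∪ Z).card := by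
      rw [funext (falsified_mul Y Z)]
      refine expect_falsified l _ hU fun p hp => ?_
      rcases Finset.mem_union.1 hp with h | h
      exacts [hYl p h, hZl p h]
    rw [hE]
    have hcard := Finset.card_union_add_card_inter Y Z
    by_cases ho : Overlap Y Z
    · have hpos : 0 < (Y ∩ Z).card := by
        obtain ⟨p, h1, h2⟩ := ho.1
        exact Finset.card_pos.2 ⟨p, Finset.mem_inter.2 ⟨h1, h2⟩⟩
      have : (1 / 2 : ℝ) ^ (r + r - 1) ≤ (1 / 2) ^ (Y ∪ Z).card :=
        pow_le_pow_of_le_one (by norm_num) (by norm_num) (by omega)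
      have h2 : (1 / 2 : ℝ) ^ (r + r) = (1 / 2) ^ (r + r - 1) * (1 / 2) := by
        rw [← pow_succ]
        congr 1
        omega
      simp only [ho, hc, if_true, if_false]
      rw [h4]
      linarith
    · have : (1 / 2 : ℝ) ^ (r + r) ≤ (1 / 2) ^ (Y ∪ Z).card :=
        pow_le_pow_of_le_one (by norm_num) (by norm_num) (by omega)
      simp only [ho, hc, if_false]
      rw [h4]
      linarith

/-- The excess of the number of satisfied clauses over its mean. -/
noncomputable def excess (r : ℕ) (C : Formula) (τ : ℕ → Bool) : ℝ :=
  ∑ Y ∈ C, ((1 / 2) ^ r - falsified Y τ)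

theorem excess_eq (r : ℕ) (C : Formula) (τ : ℕ → Bool) :
    excess r C τ = numSatisfied τ C - (1 - (1 / 2) ^ r) * C.card := by
  classical
  have h : ∑ Y ∈ C, falsified Y τ = C.card - numSatisfied τ C := by
    have h1 : ∀ Y, falsified Y τ = 1 - (if Satisfies τ Y then 1 else 0) := by
      intro Y
      by_cases hs : Satisfies τ Y <;> simp [falsified, hs]
    simp only [h1, Finset.sum_sub_distrib, Finset.sum_const, nsmul_eq_mul, mul_one,
      Finset.sum_boole, numSatisfied]
  rw [excess, Finset.sum_sub_distrib, h, Finset.sum_const, nsmul_eq_mul]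
  ring

theorem degLE_excess {r : ℕ} {C : Formula} (hC : IsExactCNF r C) (l : List ℕ) :
    DegLE l r (excess r C) := by
  refine degLE_sum l r C _ fun Y hY => ?_
  refine degLE_of_dependsOn l (S := Y.image Prod.fst) ?_
    (Finset.card_image_le.trans (hC Y hY).1.le)
  intro x y hxy
  simp only [falsified_dependsOn Y hxy]

theorem expect_excess {r : ℕ} {C : Formula} (hC : IsExactCNF r C) {l : List ℕ}
    (hl : ∀ Y ∈ C, ∀ p ∈ Y, p.1 ∈ l) : expect l (excess r C) = 0 := by
  rw [show excess r C = fun τ => ∑ Y ∈ C, ((1 / 2 : ℝ) ^ r + (-1) * falsified Y τ) by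
    funext τ
    simp only [excess, neg_one_mul, sub_eq_add_neg], expect_sum]
  refine Finset.sum_eq_zero fun Y hY => ?_
  rw [expect_add, expect_const, expect_const_mul,
    expect_falsified l Y (hC Y hY).2 (hl Y hY), (hC Y hY).1]
  ring

open Classical in
/-- A small conflict number keeps the variance of the number of satisfied clauses large. -/
theorem card_le_expect_excess_sq {r : ℕ} {C : Formula} (hC : IsExactCNF r C) {l : List ℕ}
    (hl : ∀ Y ∈ C, ∀ p ∈ Y, p.1 ∈ l)
    (hcn : conflictNumber C ≤ (2 ^ r - 2) * (C.card : ℤ)) :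
    (1 / 4 : ℝ) ^ r * C.card ≤ expect l (fun τ => excess r C τ ^ 2) := by
  have hcov : ∀ P ∈ C ×ˢ C, expect l (fun τ => ((1 / 2 : ℝ) ^ r - falsified P.1 τ)
        * ((1 / 2) ^ r - falsified P.2 τ))
      = expect l (fun τ => falsified P.1 τ * falsified P.2 τ) - (1 / 4) ^ r := by
    rintro ⟨Y, Z⟩ hP
    obtain ⟨hY, hZ⟩ := Finset.mem_product.1 hP
    have : (fun τ => ((1 / 2 : ℝ) ^ r - falsified Y τ) * ((1 / 2) ^ r - falsified Z τ))
        = fun τ => falsified Y τ * falsified Z τ + ((1 / 2) ^ r * (1 / 2) ^ r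
          + (-(1 / 2) ^ r) * (falsified Y τ + falsified Z τ)) := by
      funext τ
      ring
    simp only [this]
    rw [expect_add, expect_add, expect_const, expect_const_mul, expect_add,
      expect_falsified l Y (hC Y hY).2 (hl Y hY), expect_falsified l Z (hC Z hZ).2 (hl Z hZ),
      (hC Y hY).1, (hC Z hZ).1, show (1 / 4 : ℝ) = 1 / 2 * (1 / 2) by norm_num, mul_pow]
    ring
  have hsq : expect l (fun τ => excess r C τ ^ 2)
      = ∑ P ∈ C ×ˢ C, (expect l (fun τ => falsified P.1 τ * falsified P.2 τ) - (1 / 4) ^ r) := by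
    rw [← Finset.sum_congr rfl hcov, ← expect_sum]
    congr 1
    funext τ
    rw [sq, excess, Finset.sum_mul_sum, Finset.sum_product]
  have hdiag : ∀ Y ∈ C, expect l (fun τ => falsified Y τ * falsified Y τ) - (1 / 4 : ℝ) ^ r
      = (1 / 4) ^ r * (2 ^ r - 1) := by
    intro Y hY
    simp only [falsified_mul, Finset.union_self]
    rw [expect_falsified l Y (hC Y hY).2 (hl Y hY), (hC Y hY).1, mul_sub, ← mul_pow]
    norm_num
  have hoff : (1 / 4 : ℝ) ^ r * (-(conflictNumber C : ℝ)) ≤ ∑ P ∈ C.offDiag,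
      (expect l (fun τ => falsified P.1 τ * falsified P.2 τ) - (1 / 4) ^ r) := by
    have e : -(conflictNumber C : ℝ) = ∑ P ∈ C.offDiag,
        ((if Overlap P.1 P.2 then 1 else 0) - (if Conflict P.1 P.2 then 1 else 0)) := by
      rw [Finset.sum_sub_distrib, Finset.sum_boole, Finset.sum_boole, conflictNumber]
      push_cast
      ring
    rw [e, Finset.mul_sum]
    refine Finset.sum_le_sum fun P hP => ?_
    obtain ⟨h1, h2, -⟩ := Finset.mem_offDiag.1 hP
    exact covariance_lower_bound (hC _ h1).1 (hC _ h1).2 (hC _ h2).1 (hC _ h2).2 (hl _ h1)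
      (hl _ h2)
  rw [hsq, ← Finset.diag_union_offDiag,
    Finset.sum_union (Finset.disjoint_diag_offDiag C), Finset.sum_diag,
    Finset.sum_congr rfl hdiag, Finset.sum_const, nsmul_eq_mul]
  have hcn' : (conflictNumber C : ℝ) ≤ (2 ^ r - 2) * C.card := by exact_mod_cast hcn
  have := mul_le_mul_of_nonneg_left hcn' (show (0 : ℝ) ≤ (1 / 4) ^ r by positivity)
  linarith

/-- A formula of low conflict number with sufficiently many clauses has an assignment that
satisfies `num / 2 ^ r` clauses more than the average one. -/
theorem exists_numSatisfied_ge {r : ℕ} {C : Formula} (hC : IsExactCNF r C)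
    (hcn : conflictNumber C ≤ (2 ^ r - 2) * (C.card : ℤ)) {num : ℕ} (hnum : 0 < num)
    (hr : 0 < r) (hm : 4 * 16 ^ r * num ^ 2 ≤ C.card) :
    ∃ τ, (1 - 1 / 2 ^ r) * (C.card : ℚ) + num / 2 ^ r ≤ (numSatisfied τ C : ℚ) := by
  by_contra! hno
  set l := (C.biUnion fun Y => Y.image Prod.fst).toList with hl
  have hmem : ∀ Y ∈ C, ∀ p ∈ Y, p.1 ∈ l := by
    intro Y hY p hp
    rw [hl, Finset.mem_toList, Finset.mem_biUnion]
    exact ⟨Y, hY, Finset.mem_image_of_mem _ hp⟩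
  have hlt : ∀ τ, excess r C τ ≤ (num : ℝ) * (1 / 2) ^ r := by
    intro τ
    have h1 : ((numSatisfied τ C : ℚ) : ℝ)
        ≤ (((1 - 1 / 2 ^ r) * (C.card : ℚ) + num / 2 ^ r : ℚ) : ℝ) := by
      exact_mod_cast (hno τ).le
    push_cast at h1
    rw [excess_eq, one_div_pow, mul_one_div]
    linarith
  have h1 := expect_sq_le_of_le l (degLE_excess hC l) (expect_excess hC hmem)
    (by positivity) hlt
  have h2 := (card_le_expect_excess_sq hC hmem hcn).trans h1
  have h3 : (4 * 16 ^ r * num ^ 2 : ℝ) ≤ C.card := by exact_mod_cast hm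
  have e : (4 * 9 ^ r * ((num : ℝ) * (1 / 2) ^ r) ^ 2) = (1 / 4) ^ r * (4 * 9 ^ r * num ^ 2) := by
    rw [mul_pow, ← pow_mul, mul_comm r 2, pow_mul]
    norm_num
    ring
  rw [e] at h2
  have h4 : (C.card : ℝ) ≤ 4 * 9 ^ r * num ^ 2 := le_of_mul_le_mul_left h2 (by positivity)
  -- The factor `16 ^ r` in place of `9 ^ r` turns the bound of the moments into a contradiction.
  have h5 : (9 : ℝ) ^ r < 16 ^ r := pow_lt_pow_left₀ (by norm_num) (by norm_num) hr.ne'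
  have h6 : (0 : ℝ) < num ^ 2 := by positivity
  nlinarith

/-! ### The machine -/

/-- The stacks of the machine that computes the kernel. -/
inductive Stack where
  /-- The input, and in the end the output. -/
  | inp
  /-- The output for the part of the input that is processed, in reverse. -/
  | out
  /-- A binary counter of fixed width for the number of clauses. -/
  | cnt
  /-- The literals read so far, in reverse. -/
  | hist
  /-- The part of `hist` that the current search has passed. -/
  | past
  /-- The variable of the current literal, in reverse. -/
  | cur
  /-- The part of `cur` that the current comparison has passed. -/
  | seen
  /-- The new name of the current variable, in binary. -/
  | name
  /-- The digits that a carry has passed. -/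
  | carry
  deriving DecidableEq

instance : Fintype Stack :=
  ⟨{.inp, .out, .cnt, .hist, .past, .cur, .seen, .name, .carry}, by rintro ⟨⟩ <;> decide⟩

/-- The labels of the machine that computes the kernel. -/
inductive Label where
  | start | num | main | read | next | compare | restore | reset | inc | incBack
  | rewind | clearCur | emit | count | countBack
  | clearCnt | clearHist | deliver
  | wipeInp | wipeOut | wipeHist | wipeCarry | answer
  deriving DecidableEq

instance : Fintype Label :=
  ⟨{.start, .num, .main, .read, .next, .compare, .restore, .reset, .inc, .incBack, .rewind,
    .clearCur, .emit, .count, .countBack, .clearCnt, .clearHist, .deliver, .wipeInp, .wipeOut,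
    .wipeHist, .wipeCarry, .answer}, by rintro ⟨⟩ <;> decide⟩

/-- The internal state of the machine: two symbols, and the result of the current comparison. -/
abbrev Reg := Option Sym × Option Sym × Bool

/-- Is the symbol a digit? -/
def isBit : Option Sym → Bool
  | some (Sym.bit _) => true
  | _ => false

/-- The digit, if the symbol is one. -/
def toBit : Option Sym → Option Bool
  | some (Sym.bit b) => some b
  | _ => none

/-- Statements of the machine. -/
abbrev Code := Turing.TM2.Stmt (fun _ : Stack => Sym) Label Reg

namespace Code

open Turing.TM2.Stmt

/-- Forget the two symbols and go to the label `l`. -/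
def jump (l : Label) : Code := load (fun v => (none, none, v.2.2)) (goto fun _ => l)

/-- Remove the top of a stack and keep it as the first symbol. -/
def pop₁ (k : Stack) (q : Code) : Code := pop k (fun v s => (s, v.2)) q

/-- Keep the top of a stack as the first symbol. -/
def peek₁ (k : Stack) (q : Code) : Code := peek k (fun v s => (s, v.2)) q

/-- Keep the top of a stack as the second symbol. -/
def peek₂ (k : Stack) (q : Code) : Code := peek k (fun v s => (v.1, s, v.2.2)) q

/-- Remove the top of a stack. -/
def drop (k : Stack) (q : Code) : Code := pop k (fun v _ => v) q

/-- Push the first symbol. -/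
def push₁ (k : Stack) (q : Code) : Code := push k (fun v => v.1.getD Sym.clause) q

/-- Push the second symbol. -/
def push₂ (k : Stack) (q : Code) : Code := push k (fun v => v.2.1.getD Sym.clause) q

/-- Push a given symbol. -/
def put (k : Stack) (s : Sym) (q : Code) : Code := push k (fun _ => s) q

/-- Push the symbols of a word, the last one first. -/
def putList (k : Stack) (w : List Sym) (q : Code) : Code :=
  w.foldl (fun q s => put k s q) q

/-- Empty the stack `k`; `self` is the label of this statement. -/
def clear (k : Stack) (self after : Label) : Code :=
  pop₁ k (branch (fun v => v.1.isSome) (jump self) (jump after))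

/-- Move the stack `k` onto `k'`, in reverse; `self` is the label of this statement. -/
def move (k k' : Stack) (self : Label) (after : Code) : Code :=
  pop₁ k (branch (fun v => v.1.isSome) (push₁ k' (jump self)) after)

end Code

open Turing.TM2.Stmt Code in
/-- The program. The clause counter `cnt` has `w` digits and two more for each digit of the given
number; as soon as it overflows, the stacks are wiped and the word `a` is delivered. -/
def program (w : ℕ) (a : List Sym) : Label → Code
  | .start => putList .cnt (List.replicate w (Sym.bit false)) (jump .num)
  | .num => peek₁ .inp <| branch (fun v => isBit v.1)
      (drop .inp <| push₁ .out <| put .cnt (Sym.bit false) <| put .cnt (Sym.bit false) <|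
        jump .num)
      (jump .main)
  -- The input is now at the mark of a clause, at the sign of a literal, or at its end.
  | .main => pop₁ .inp <| branch (fun v => v.1.isNone) (jump .clearCnt) <|
      branch (fun v => decide (v.1 = some Sym.clause))
        (push₁ .out <| jump .count)
        (push₁ .out <| push₁ .hist <| jump .read)
  -- Add one to the clause counter.
  | .count => pop₁ .cnt <| branch (fun v => v.1.isNone) (jump .wipeInp) <|
      branch (fun v => decide (v.1 = some (Sym.bit true)))
        (put .carry (Sym.bit false) <| jump .count)
        (put .cnt (Sym.bit true) <| jump .countBack)
  | .countBack => move .carry .cnt .countBack (jump .main)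
  -- Read a variable, and search for it among the literals read so far, itself included.
  | .read => peek₁ .inp <| branch (fun v => isBit v.1)
      (drop .inp <| push₁ .cur <| push₁ .hist <| jump .read)
      (jump .next)
  | .next => peek₁ .hist <| branch (fun v => v.1.isNone) (jump .rewind)
      (load (fun _ => (none, none, true)) <| jump .compare)
  -- Pass the digits of the current variable and of a variable on `hist` in parallel. The two words
  -- may have different lengths; the comparison ends when the sign of the latter is on top and
  -- the former is used up.
  | .compare => peek₁ .cur <| peek₂ .hist <|
      load (fun v => (v.1, v.2.1, v.2.2 && decide (toBit v.1 = toBit v.2.1))) <|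
      branch (fun v => isBit v.1)
        (drop .cur <| push₁ .seen <| branch (fun v => isBit v.2.1)
          (drop .hist <| push₂ .past <| jump .compare)
          (jump .compare))
        (drop .hist <| push₂ .past <| branch (fun v => isBit v.2.1)
          (jump .compare)
          (jump .restore))
  | .restore => move .seen .cur .restore <| branch (fun v => v.2.2) (jump .reset) (jump .inc)
  -- Set the name to zero if the variables are equal, and otherwise add one to it.
  | .reset => clear .name .reset .next
  | .inc => pop₁ .name <| branch (fun v => decide (v.1 = some (Sym.bit true)))
      (put .carry (Sym.bit false) <| jump .inc)
      (put .name (Sym.bit true) <| jump .incBack)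
  | .incBack => move .carry .name .incBack (jump .next)
  -- The search is over: restore `hist` and write the name.
  | .rewind => move .past .hist .rewind (jump .clearCur)
  | .clearCur => clear .cur .clearCur .emit
  | .emit => move .name .out .emit (jump .main)
  -- The input is used up: deliver `out`.
  | .clearCnt => clear .cnt .clearCnt .clearHist
  | .clearHist => clear .hist .clearHist .deliver
  | .deliver => move .out .inp .deliver <| load (fun _ => (none, none, false)) halt
  -- The clause counter has overflowed.
  | .wipeInp => clear .inp .wipeInp .wipeOut
  | .wipeOut => clear .out .wipeOut .wipeHist
  | .wipeHist => clear .hist .wipeHist .wipeCarry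
  | .wipeCarry => clear .carry .wipeCarry .answer
  | .answer => putList .inp a <| load (fun _ => (none, none, false)) halt

/-- The machine that computes the kernel. -/
def machine (w : ℕ) (a : List Sym) : Turing.FinTM2 where
  K := Stack
  k₀ := .inp
  k₁ := .inp
  Γ _ := Sym
  Λ := Label
  main := .start
  σ := Reg
  initialState := (none, none, false)
  Γk₀Fin := inferInstanceAs (Fintype Sym)
  m := program w a

/-- The contents of the stacks. -/
structure Mem where
  inp : List Sym := []
  out : List Sym := []
  cnt : List Sym := []
  hist : List Sym := []
  past : List Sym := []
  cur : List Sym := []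
  seen : List Sym := []
  name : List Sym := []
  carry : List Sym := []

/-- The contents of the stacks as a function on the stacks. -/
def Mem.get (m : Mem) : Stack → List Sym
  | .inp => m.inp
  | .out => m.out
  | .cnt => m.cnt
  | .hist => m.hist
  | .past => m.past
  | .cur => m.cur
  | .seen => m.seen
  | .name => m.name
  | .carry => m.carry

/-- Replace the contents of one stack. -/
def Mem.set (m : Mem) (l : List Sym) : Stack → Mem
  | .inp => { m with inp := l }
  | .out => { m with out := l }
  | .cnt => { m with cnt := l }
  | .hist => { m with hist := l }
  | .past => { m with past := l }
  | .cur => { m with cur := l }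
  | .seen => { m with seen := l }
  | .name => { m with name := l }
  | .carry => { m with carry := l }

theorem Mem.update_get (m : Mem) (k : Stack) (l : List Sym) :
    Function.update m.get k l = (m.set l k).get := by
  funext j
  cases k <;> cases j <;> rfl

/-- The configuration before the statement at a label, with a comparison flag and given contents
of the stacks. -/
def cfg (l : Label) (e : Bool) (m : Mem) : Turing.TM2.Cfg (fun _ : Stack => Sym) Label Reg :=
  ⟨some l, (none, none, e), m.get⟩

/-- The configuration in which the machine stops. -/
def halted (m : Mem) : Turing.TM2.Cfg (fun _ : Stack => Sym) Label Reg :=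
  ⟨none, (none, none, false), m.get⟩

/-- `Reach w a n c d`: the machine passes from `c` to `d` in at most `n` steps. -/
def Reach (w : ℕ) (a : List Sym) (n : ℕ)
    (c d : Turing.TM2.Cfg (fun _ : Stack => Sym) Label Reg) : Prop :=
  Nonempty (StateTransition.EvalsToInTime (Turing.TM2.step (program w a)) c (some d) n)

section Runs

variable {w : ℕ} {a : List Sym}

theorem Reach.refl (n : ℕ) (c : Turing.TM2.Cfg (fun _ : Stack => Sym) Label Reg) :
    Reach w a n c c :=
  ⟨⟨⟨0, rfl⟩, Nat.zero_le n⟩⟩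

theorem Reach.mono {n n' : ℕ} {c d : Turing.TM2.Cfg (fun _ : Stack => Sym) Label Reg}
    (h : Reach w a n c d) (hn : n ≤ n') : Reach w a n' c d := by
  obtain ⟨h⟩ := h
  exact ⟨⟨h.toEvalsTo, h.steps_le_m.trans hn⟩⟩

theorem Reach.trans {n n' : ℕ} {c d e : Turing.TM2.Cfg (fun _ : Stack => Sym) Label Reg}
    (h : Reach w a n c d) (h' : Reach w a n' d e) : Reach w a (n + n') c e := by
  obtain ⟨h⟩ := h
  obtain ⟨h'⟩ := h'
  refine ⟨?_⟩
  rw [add_comm]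
  exact StateTransition.EvalsToInTime.trans _ _ _ _ _ _ h h'

theorem Reach.step {c d : Turing.TM2.Cfg (fun _ : Stack => Sym) Label Reg}
    (h : Turing.TM2.step (program w a) c = some d) : Reach w a 1 c d :=
  ⟨⟨⟨1, h⟩, le_rfl⟩⟩

theorem Reach.cons {n : ℕ} {c d e : Turing.TM2.Cfg (fun _ : Stack => Sym) Label Reg}
    (h : Turing.TM2.step (program w a) c = some d) (h' : Reach w a n d e) :
    Reach w a (n + 1) c e := by
  rw [add_comm]
  exact (Reach.step h).trans h'

/-! ### Loops of the machine -/

theorem step_clear_cons {k : Stack} {self after : Label} {e : Bool} {m : Mem} {s : Sym}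
    {l : List Sym} (hp : program w a self = Code.clear k self after) (hm : m.get k = s :: l) :
    Turing.TM2.step (program w a) (cfg self e m) = some (cfg self e (m.set l k)) := by
  simp [cfg, hp, Code.clear, Code.pop₁, Code.jump, hm, Mem.update_get]

theorem step_clear_nil {k : Stack} {self after : Label} {e : Bool} {m : Mem}
    (hp : program w a self = Code.clear k self after) (hm : m.get k = []) :
    Turing.TM2.step (program w a) (cfg self e m) = some (cfg after e m) := by
  have : Function.update m.get k [] = m.get := by rw [← hm, Function.update_eq_self]
  simp [cfg, hp, Code.clear, Code.pop₁, Code.jump, hm, this]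

theorem reach_clear {k : Stack} {self after : Label} {e : Bool}
    (hp : program w a self = Code.clear k self after) (l : List Sym) (m : Mem)
    (hm : m.get k = l) :
    Reach w a (l.length + 1) (cfg self e m) (cfg after e (m.set [] k)) := by
  induction l generalizing m with
  | nil =>
    have : m.set [] k = m := by
      cases k <;> cases m <;> cases hm <;> rfl
    rw [this]
    exact Reach.step (step_clear_nil hp hm)
  | cons s l ih =>
    have h := ih (m.set l k) (by cases k <;> rfl)
    have : (m.set l k).set [] k = m.set [] k := by cases k <;> rfl
    rw [this] at h
    exact Reach.cons (step_clear_cons hp hm) h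

theorem reach_move {k k' : Stack} (hk : k ≠ k') {self : Label} {after : Code} {e : Bool}
    (hp : program w a self = Code.move k k' self after) (l : List Sym) (m : Mem)
    (hm : m.get k = l) :
    Reach w a l.length (cfg self e m)
      (cfg self e ((m.set [] k).set (l.reverse ++ m.get k') k')) := by
  induction l generalizing m with
  | nil =>
    have : (m.set [] k).set ([].reverse ++ m.get k') k' = m := by
      cases k <;> cases k' <;> cases m <;> cases hm <;> rfl
    rw [this]
    exact Reach.refl _ _
  | cons s l ih =>
    have hstep : Turing.TM2.step (program w a) (cfg self e m)
        = some (cfg self e ((m.set l k).set (s :: m.get k') k')) := by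
      have : (m.set l k).get k' = m.get k' := by
        cases k <;> cases k' <;> first | rfl | exact absurd rfl hk
      simp [cfg, hp, Code.move, Code.pop₁, Code.push₁, Code.jump, hm, Mem.update_get, this]
    have h := ih ((m.set l k).set (s :: m.get k') k') (by
      cases k <;> cases k' <;> first | rfl | exact absurd rfl hk)
    have : (((m.set l k).set (s :: m.get k') k').set [] k).set
        (l.reverse ++ ((m.set l k).set (s :: m.get k') k').get k') k'
        = (m.set [] k).set ((s :: l).reverse ++ m.get k') k' := by
      cases k <;> cases k' <;> first | exact absurd rfl hk | simp [Mem.set, Mem.get]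
    rw [this] at h
    exact Reach.cons hstep h

/-- A move followed by a jump. -/
theorem reach_move_jump {k k' : Stack} (hk : k ≠ k') {self after : Label} {e : Bool}
    (hp : program w a self = Code.move k k' self (Code.jump after)) (l : List Sym) (m : Mem)
    (hm : m.get k = l) :
    Reach w a (l.length + 1) (cfg self e m)
      (cfg after e ((m.set [] k).set (l.reverse ++ m.get k') k')) := by
  refine (reach_move hk hp l m hm).trans (Reach.step ?_)
  have hg : ((m.set [] k).set (l.reverse ++ m.get k') k').get k = [] := by
    cases k <;> cases k' <;> first | rfl | exact absurd rfl hk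
  have := Function.update_eq_self k ((m.set [] k).set (l.reverse ++ m.get k') k').get
  rw [hg] at this
  simp [cfg, hp, Code.move, Code.pop₁, Code.jump, hg, this]

section Steps

attribute [local simp] cfg halted program Code.peek₁ Code.peek₂ Code.pop₁ Code.jump Code.drop
  Code.push₁ Code.push₂ Code.put Code.move Mem.update_get isBit toBit Mem.set Mem.get

variable {e : Bool} {m : Mem} {b c : Bool} {i l l' : List Sym}

/-- `s` does not start with a digit. -/
def NoBit (s : List Sym) : Prop := isBit s.head? = false

theorem step_num_bit (h : m.inp = Sym.bit b :: i) :
    Turing.TM2.step (program w a) (cfg .num e m) = some (cfg .num e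
      { m with inp := i, out := Sym.bit b :: m.out,
               cnt := Sym.bit false :: Sym.bit false :: m.cnt }) := by
  simp [h]

theorem step_num_main (h : NoBit m.inp) :
    Turing.TM2.step (program w a) (cfg .num e m) = some (cfg .main e m) := by
  rw [NoBit] at h
  simp [h, -isBit]

theorem step_main_nil (h : m.inp = []) :
    Turing.TM2.step (program w a) (cfg .main e m) = some (cfg .clearCnt e m) := by
  cases m
  cases h
  simp

theorem step_main_clause (h : m.inp = Sym.clause :: i) :
    Turing.TM2.step (program w a) (cfg .main e m) = some (cfg .count e
      { m with inp := i, out := Sym.clause :: m.out }) := by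
  simp [h]

theorem step_main_sign (h : m.inp = Sym.sign b :: i) :
    Turing.TM2.step (program w a) (cfg .main e m) = some (cfg .read e
      { m with inp := i, out := Sym.sign b :: m.out, hist := Sym.sign b :: m.hist }) := by
  simp [h]

theorem step_count_nil (h : m.cnt = []) :
    Turing.TM2.step (program w a) (cfg .count e m) = some (cfg .wipeInp e m) := by
  cases m
  cases h
  simp

theorem step_count_true (h : m.cnt = Sym.bit true :: l) :
    Turing.TM2.step (program w a) (cfg .count e m) = some (cfg .count e
      { m with cnt := l, carry := Sym.bit false :: m.carry }) := by
  simp [h]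

theorem step_count_false (h : m.cnt = Sym.bit false :: l) :
    Turing.TM2.step (program w a) (cfg .count e m) = some (cfg .countBack e
      { m with cnt := Sym.bit true :: l }) := by
  simp [h]

theorem step_read_bit (h : m.inp = Sym.bit b :: i) :
    Turing.TM2.step (program w a) (cfg .read e m) = some (cfg .read e
      { m with inp := i, cur := Sym.bit b :: m.cur, hist := Sym.bit b :: m.hist }) := by
  simp [h]

theorem step_read_next (h : NoBit m.inp) :
    Turing.TM2.step (program w a) (cfg .read e m) = some (cfg .next e m) := by
  rw [NoBit] at h
  simp [h, -isBit]

theorem step_next_nil (h : m.hist = []) :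
    Turing.TM2.step (program w a) (cfg .next e m) = some (cfg .rewind e m) := by
  simp [h]

theorem step_next_cons (h : m.hist ≠ []) :
    Turing.TM2.step (program w a) (cfg .next e m) = some (cfg .compare true m) := by
  obtain ⟨s, l, h⟩ := List.exists_cons_of_ne_nil h
  simp [h]

theorem step_compare_bit_bit (h : m.cur = Sym.bit b :: l) (h' : m.hist = Sym.bit c :: l') :
    Turing.TM2.step (program w a) (cfg .compare e m) = some (cfg .compare (e && decide (b = c))
      { m with cur := l, seen := Sym.bit b :: m.seen, hist := l',
               past := Sym.bit c :: m.past }) := by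
  simp [h, h']

theorem step_compare_bit_sign (h : m.cur = Sym.bit b :: l) (h' : m.hist = Sym.sign c :: l') :
    Turing.TM2.step (program w a) (cfg .compare e m) = some (cfg .compare false
      { m with cur := l, seen := Sym.bit b :: m.seen }) := by
  simp [h, h']

theorem step_compare_nil_bit (h : m.cur = []) (h' : m.hist = Sym.bit c :: l') :
    Turing.TM2.step (program w a) (cfg .compare e m) = some (cfg .compare false
      { m with hist := l', past := Sym.bit c :: m.past }) := by
  simp [h, h']

theorem step_compare_nil_sign (h : m.cur = []) (h' : m.hist = Sym.sign c :: l') :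
    Turing.TM2.step (program w a) (cfg .compare e m) = some (cfg .restore e
      { m with hist := l', past := Sym.sign c :: m.past }) := by
  simp [h, h']

theorem step_restore_nil (h : m.seen = []) :
    Turing.TM2.step (program w a) (cfg .restore e m)
      = some (cfg (if e then .reset else .inc) e m) := by
  cases m
  cases h
  cases e <;> simp

theorem step_inc_nil (h : m.name = []) :
    Turing.TM2.step (program w a) (cfg .inc e m) = some (cfg .incBack e
      { m with name := [Sym.bit true] }) := by
  simp [h]

theorem step_inc_true (h : m.name = Sym.bit true :: l) :
    Turing.TM2.step (program w a) (cfg .inc e m) = some (cfg .inc e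
      { m with name := l, carry := Sym.bit false :: m.carry }) := by
  simp [h]

theorem step_inc_false (h : m.name = Sym.bit false :: l) :
    Turing.TM2.step (program w a) (cfg .inc e m) = some (cfg .incBack e
      { m with name := Sym.bit true :: l }) := by
  simp [h]

theorem step_deliver_nil (h : m.out = []) :
    Turing.TM2.step (program w a) (cfg .deliver e m) = some (halted m) := by
  cases m
  cases h
  simp

theorem stepAux_putList (k : Stack) (u : List Sym) (q : Code) (v : Reg) (m : Mem) :
    Turing.TM2.stepAux (Code.putList k u q) v m.get
      = Turing.TM2.stepAux q v (m.set (u ++ m.get k) k).get := by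
  induction u generalizing q with
  | nil =>
    have : m.set (m.get k) k = m := by cases k <;> rfl
    simp [Code.putList, this, -Mem.set, -Mem.get]
  | cons s u ih =>
    have h1 : Code.putList k (s :: u) q = Code.putList k u (Code.put k s q) := rfl
    have h2 : (m.set (u ++ m.get k) k).get k = u ++ m.get k := by cases k <;> rfl
    have h3 : (m.set (u ++ m.get k) k).set (s :: (u ++ m.get k)) k
        = m.set (s :: u ++ m.get k) k := by cases k <;> rfl
    rw [h1, ih, Code.put, Turing.TM2.stepAux, Mem.update_get, h2, h3]

theorem step_start :
    Turing.TM2.step (program w a) (cfg .start e m) = some (cfg .num e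
      { m with cnt := List.replicate w (Sym.bit false) ++ m.cnt }) := by
  simp [stepAux_putList, -Mem.get]
  simp

theorem step_answer (h : m.inp = []) :
    Turing.TM2.step (program w a) (cfg .answer e m) = some (halted { m with inp := a }) := by
  simp [stepAux_putList, -Mem.get]
  simp [h]

end Steps

/-! ### Binary numbers -/

/-- Add one to a number in binary, least significant digit first. -/
def incBits : List Bool → List Bool
  | [] => [true]
  | false :: l => true :: l
  | true :: l => false :: incBits l

theorem encodePosNum_succ (p : PosNum) : encodePosNum p.succ = incBits (encodePosNum p) := by
  induction p with
  | one => rfl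
  | bit0 p _ => rfl
  | bit1 p ih => simp [PosNum.succ, encodePosNum, incBits, ih]

theorem encodeNat_succ (n : ℕ) : encodeNat (n + 1) = incBits (encodeNat n) := by
  have h : ((n + 1 : ℕ) : Num) = Num.succ (n : Num) := by
    rw [Nat.cast_succ, Num.add_one]
  rw [encodeNat, encodeNat, h]
  cases (n : Num) with
  | zero => rfl
  | pos p => exact encodePosNum_succ p

theorem length_incBits_le (l : List Bool) : (incBits l).length ≤ l.length + 1 := by
  induction l with
  | nil => simp [incBits]
  | cons b l ih => cases b <;> simp [incBits, ih]

theorem length_encodeNat_le (n : ℕ) : (encodeNat n).length ≤ n := by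
  induction n with
  | zero => exact le_rfl
  | succ n ih =>
    rw [encodeNat_succ]
    exact (length_incBits_le _).trans (by omega)

theorem encodePosNum_bounds (p : PosNum) :
    (p : ℕ) < 2 ^ (encodePosNum p).length ∧ 2 ^ (encodePosNum p).length ≤ 2 * (p : ℕ) := by
  induction p with
  | one => simp [encodePosNum]
  | bit0 p ih =>
    simp only [encodePosNum, List.length_cons, pow_succ, PosNum.cast_bit0]
    omega
  | bit1 p ih =>
    simp only [encodePosNum, List.length_cons, pow_succ, PosNum.cast_bit1]
    omega

theorem encodeNat_bounds {n : ℕ} (hn : 0 < n) :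
    n < 2 ^ (encodeNat n).length ∧ 2 ^ (encodeNat n).length ≤ 2 * n := by
  have h : ((n : Num) : ℕ) = n := Num.to_of_nat n
  rw [encodeNat]
  cases hp : (n : Num) with
  | zero =>
    rw [hp] at h
    have : n = 0 := h.symm
    omega
  | pos p =>
    rw [hp, Num.cast_pos] at h
    have := encodePosNum_bounds p
    rw [h] at this
    exact this

theorem length_encodeNumber (n : ℕ) : (encodeNumber n).length = (encodeNat n).length := by
  simp [encodeNumber]

theorem length_encodeNumber_le (n : ℕ) : (encodeNumber n).length ≤ n := by
  rw [length_encodeNumber]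
  exact length_encodeNat_le n

theorem encodeNat_injective : Function.Injective encodeNat := fun m n h => by
  rw [← Computability.decode_encodeNat m, h, Computability.decode_encodeNat]

/-- The last `t` binary digits of `x`, least significant digit first. -/
def fixedBits : ℕ → ℕ → List Bool
  | 0, _ => []
  | t + 1, x => decide (x % 2 = 1) :: fixedBits t (x / 2)

theorem length_fixedBits (t x : ℕ) : (fixedBits t x).length = t := by
  induction t generalizing x with
  | zero => rfl
  | succ t ih => simp [fixedBits, ih]

theorem fixedBits_zero (t : ℕ) : fixedBits t 0 = List.replicate t false := by
  induction t with
  | zero => rfl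
  | succ t ih => simp [fixedBits, ih, List.replicate_succ]

/-! ### The counters of the machine -/

/-- A counter that does not overflow. -/
theorem reach_count {e : Bool} {t x k : ℕ} {m : Mem}
    (hc : m.cnt = (fixedBits t x).map Sym.bit)
    (hk : m.carry = List.replicate k (Sym.bit false)) (hx : x + 1 < 2 ^ t) :
    Reach w a (2 * t + k + 2) (cfg .count e m) (cfg .main e
      { m with carry := [],
               cnt := List.replicate k (Sym.bit false) ++ (fixedBits t (x + 1)).map Sym.bit }) := by
  induction t generalizing x k m with
  | zero => simp at hx
  | succ t ih =>
    rw [pow_succ] at hx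
    obtain ⟨y, rfl | rfl⟩ := Nat.even_or_odd' x
    · have e1 : (2 * y) / 2 = y := by omega
      have e2 : (2 * y + 1) / 2 = y := by omega
      have e3 : (2 * y + 1) % 2 = 1 := by omega
      simp only [fixedBits, e1, Nat.mul_mod_right, zero_ne_one, decide_false, List.map_cons] at hc
      simp only [fixedBits, e2, e3, decide_true, List.map_cons]
      have h := reach_move_jump (w := w) (a := a) (e := e) (k := .carry) (k' := .cnt) (by decide)
        (self := .countBack) (after := .main) rfl _
        { m with cnt := Sym.bit true :: (fixedBits t y).map Sym.bit } hk
      rw [List.reverse_replicate, List.length_replicate] at h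
      exact (Reach.cons (step_count_false hc) h).mono (by omega)
    · have e1 : (2 * y + 1) / 2 = y := by omega
      have e2 : (2 * y + 1 + 1) / 2 = y + 1 := by omega
      have e3 : (2 * y + 1) % 2 = 1 := by omega
      have e4 : (2 * y + 1 + 1) % 2 = 0 := by omega
      simp only [fixedBits, e1, e3, decide_true, List.map_cons] at hc
      simp only [fixedBits, e2, e4, zero_ne_one, decide_false, List.map_cons]
      have h := ih (x := y) (k := k + 1) (m := { m with
        cnt := (fixedBits t y).map Sym.bit, carry := Sym.bit false :: m.carry }) rfl
        (by rw [hk, List.replicate_succ]) (by omega)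
      rw [List.replicate_succ', List.append_assoc, List.singleton_append] at h
      exact (Reach.cons (step_count_true hc) h).mono (by omega)

/-- A counter that overflows. -/
theorem reach_count_overflow {e : Bool} {t x k : ℕ} {m : Mem}
    (hc : m.cnt = (fixedBits t x).map Sym.bit)
    (hk : m.carry = List.replicate k (Sym.bit false)) (hx : x + 1 = 2 ^ t) :
    Reach w a (t + 1) (cfg .count e m) (cfg .wipeInp e
      { m with carry := List.replicate (k + t) (Sym.bit false), cnt := [] }) := by
  induction t generalizing x k m with
  | zero =>
    obtain ⟨⟩ := m
    subst hk
    cases hc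
    exact Reach.step (step_count_nil rfl)
  | succ t ih =>
    rw [pow_succ] at hx
    obtain ⟨y, rfl⟩ : ∃ y, x = 2 * y + 1 := ⟨x / 2, by omega⟩
    have e1 : (2 * y + 1) / 2 = y := by omega
    have e3 : (2 * y + 1) % 2 = 1 := by omega
    simp only [fixedBits, e1, e3, decide_true, List.map_cons] at hc
    have h := ih (x := y) (k := k + 1) (m := { m with
      cnt := (fixedBits t y).map Sym.bit, carry := Sym.bit false :: m.carry }) rfl
      (by rw [hk, List.replicate_succ]) (by omega)
    rw [show k + 1 + t = k + (t + 1) by omega] at h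
    exact Reach.cons (step_count_true hc) h

theorem reach_inc {e : Bool} {l : List Bool} {k : ℕ} {m : Mem} (hn : m.name = l.map Sym.bit)
    (hk : m.carry = List.replicate k (Sym.bit false)) :
    Reach w a (2 * l.length + k + 2) (cfg .inc e m) (cfg .next e
      { m with carry := [],
               name := List.replicate k (Sym.bit false) ++ (incBits l).map Sym.bit }) := by
  have back : ∀ u, Reach w a (k + 1) (cfg .incBack e { m with name := u }) (cfg .next e
      { m with carry := [], name := List.replicate k (Sym.bit false) ++ u }) := by
    intro u
    have h := reach_move_jump (w := w) (a := a) (e := e) (k := .carry) (k' := .name) (by decide)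
      (self := .incBack) (after := .next) rfl _ { m with name := u } hk
    rwa [List.reverse_replicate, List.length_replicate] at h
  induction l generalizing k m with
  | nil => exact (Reach.cons (step_inc_nil hn) (back _)).mono (by simp)
  | cons b l ih =>
    cases b with
    | false => exact (Reach.cons (step_inc_false hn) (back _)).mono (by omega)
    | true =>
      have hk' : Sym.bit false :: m.carry = List.replicate (k + 1) (Sym.bit false) := by
        rw [hk, List.replicate_succ]
      have h := ih (k := k + 1) (m := { m with
        name := l.map Sym.bit, carry := Sym.bit false :: m.carry }) rfl hk' (by
          intro u
          have h := reach_move_jump (w := w) (a := a) (e := e) (k := .carry) (k' := .name)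
            (by decide) (self := .incBack) (after := .next) rfl _
            { m with name := u, carry := Sym.bit false :: m.carry } hk'
          rwa [List.reverse_replicate, List.length_replicate] at h)
      rw [List.replicate_succ', List.append_assoc, List.singleton_append] at h
      refine (Reach.cons (step_inc_true hn) h).mono ?_
      simp only [List.length_cons]
      omega

/-! ### The search of the machine -/

theorem reach_compare {e : Bool} (l l' : List Bool) {c : Bool} {u : List Sym} {m : Mem}
    (hl : m.cur = l.map Sym.bit) (hl' : m.hist = l'.map Sym.bit ++ Sym.sign c :: u) :
    Reach w a (l.length + l'.length + 1) (cfg .compare e m)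
      (cfg .restore (e && decide (l = l'))
        { m with cur := [], seen := l.reverse.map Sym.bit ++ m.seen, hist := u,
                 past := Sym.sign c :: (l'.reverse.map Sym.bit ++ m.past) }) := by
  induction l generalizing e l' m with
  | nil =>
    induction l' generalizing e m with
    | nil =>
      obtain ⟨⟩ := m
      subst hl hl'
      simpa using Reach.step (step_compare_nil_sign rfl rfl)
    | cons b' l' ih' =>
      have h := ih' (e := false) (m := { m with
        hist := l'.map Sym.bit ++ Sym.sign c :: u, past := Sym.bit b' :: m.past }) hl rfl
      have := Reach.cons (step_compare_nil_bit (e := e) hl hl') h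
      simpa [add_assoc] using this
  | cons b l ih =>
    cases l' with
    | nil =>
      have h := ih (e := false) [] (m := { m with
        cur := l.map Sym.bit, seen := Sym.bit b :: m.seen }) rfl hl'
      have := Reach.cons (step_compare_bit_sign (e := e) hl hl') h
      refine Reach.mono (n := l.length + 1 + 1) ?_ (by simp)
      simpa [add_assoc] using this
    | cons b' l' =>
      have h := ih (e := e && decide (b = b')) l' (m := { m with
        cur := l.map Sym.bit, seen := Sym.bit b :: m.seen,
        hist := l'.map Sym.bit ++ Sym.sign c :: u, past := Sym.bit b' :: m.past }) rfl rfl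
      have := Reach.cons (step_compare_bit_bit (e := e) hl hl') h
      refine Reach.mono (n := l.length + l'.length + 1 + 1) ?_ (by simp; omega)
      simpa [Bool.and_assoc, List.cons.injEq] using this

/-- One step of the search: the current variable `v` is compared with the variable `u`. -/
theorem reach_next {e : Bool} {u v c n : ℕ} {b : Bool} {h : List Sym} {m : Mem}
    (hh : m.hist = (encodeNumber u).reverse ++ Sym.sign b :: h)
    (hc : m.cur = (encodeNumber v).reverse) (hn : m.name = encodeNumber c)
    (hs : m.seen = []) (hk : m.carry = []) (hu : (encodeNumber u).length ≤ n)
    (hv : (encodeNumber v).length ≤ n) (hcn : (encodeNumber c).length ≤ n) :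
    ∃ e', Reach w a (5 * n + 6) (cfg .next e m) (cfg .next e'
      { m with hist := h, past := Sym.sign b :: (encodeNumber u ++ m.past),
               name := encodeNumber (if u = v then 0 else c + 1) }) := by
  have hh' : m.hist = (encodeNat u).reverse.map Sym.bit ++ Sym.sign b :: h := by
    rw [hh, encodeNumber, List.map_reverse]
  have hc' : m.cur = (encodeNat v).reverse.map Sym.bit := by
    rw [hc, encodeNumber, List.map_reverse]
  rw [length_encodeNumber] at hu hv hcn
  have h1 := Reach.cons (w := w) (a := a) (step_next_cons (e := e) (by simp [hh]))
    (reach_compare _ _ hc' hh')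
  simp only [List.reverse_reverse, List.length_reverse, Bool.true_and, hs, List.append_nil] at h1
  have h2 := h1.trans (reach_move (k := .seen) (k' := .cur) (by decide) (self := .restore) rfl _ _
    rfl)
  simp only [Mem.get, Mem.set, List.length_map, List.append_nil] at h2
  have h3 := h2.trans (Reach.step (step_restore_nil rfl))
  have hdec : decide ((encodeNat v).reverse = (encodeNat u).reverse) = decide (u = v) := by
    simp [List.reverse_inj, encodeNat_injective.eq_iff, eq_comm]
  rw [hdec] at h3
  by_cases huv : u = v
  · simp only [huv, decide_true, if_true] at h3 ⊢
    have h4 := h3.trans (reach_clear (k := .name) (self := .reset) (after := .next) rfl _ _ hn)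
    rw [length_encodeNumber] at h4
    refine ⟨true, ?_⟩
    convert h4.mono (n' := 5 * n + 6) (by omega) using 2
    simp [Mem.set, hs, hc, encodeNumber]
    rfl
  · simp only [huv, decide_false, Bool.false_eq_true, if_false] at h3 ⊢
    have h4 := h3.trans (reach_inc (l := encodeNat c) (k := 0) hn hk)
    refine ⟨false, ?_⟩
    convert h4.mono (n' := 5 * n + 6) (by omega) using 2
    simp [hs, hc, hk, encodeNumber, encodeNat_succ]

/-! ### Runs of the machine -/

/-- The literals `h` as they stand on the stack `hist`. -/
def histWord (h : List Literal) : List Sym :=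
  h.flatMap fun p => (encodeNumber p.1).reverse ++ [Sym.sign p.2]

theorem histWord_cons (p : Literal) (h : List Literal) :
    histWord (p :: h) = (encodeNumber p.1).reverse ++ Sym.sign p.2 :: histWord h := by
  simp [histWord]

theorem length_histWord_cons (p : Literal) (h : List Literal) :
    (histWord (p :: h)).length = (encodeLiteral p).length + (histWord h).length := by
  simp [histWord_cons, encodeLiteral]
  omega

theorem length_le_length_histWord (h : List Literal) : h.length ≤ (histWord h).length := by
  induction h with
  | nil => simp
  | cons p h ih =>
    rw [length_histWord_cons, List.length_cons, encodeLiteral, List.length_cons]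
    omega

/-- The value of the name counter after the search has passed the literals `us`. -/
def scan (v : ℕ) : List Literal → ℕ → ℕ
  | [], c => c
  | u :: us, c => scan v us (if u.1 = v then 0 else c + 1)

theorem scan_append_singleton (v : ℕ) (us : List Literal) (u : Literal) (c : ℕ) :
    scan v (us ++ [u]) c = if u.1 = v then 0 else scan v us c + 1 := by
  induction us generalizing c with
  | nil => rfl
  | cons u' us ih => simp only [List.cons_append, scan, ih]

/-- Since the search runs from the newest literal to the oldest, it finds the number of literals
before the first occurrence of the variable. -/
theorem scan_eq_idxOf (v : ℕ) (us : List Literal) :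
    scan v us 0 = (us.reverse.map Prod.fst).idxOf v := by
  induction us using List.reverseRecOn with
  | nil => rfl
  | append_singleton us u ih =>
    rw [scan_append_singleton, ih]
    simp [List.idxOf_cons]

theorem reach_scan {n v : ℕ} (us : List Literal) {e : Bool} {c : ℕ} {m : Mem}
    (hh : m.hist = histWord us) (hc : m.cur = (encodeNumber v).reverse)
    (hn : m.name = encodeNumber c) (hs : m.seen = []) (hk : m.carry = [])
    (hl : c + (histWord us).length ≤ n) (hv : (encodeNumber v).length ≤ n) :
    ∃ e', Reach w a (us.length * (5 * n + 6) + 1) (cfg .next e m) (cfg .rewind e'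
      { m with hist := [], past := (histWord us).reverse ++ m.past,
               name := encodeNumber (scan v us c) }) := by
  induction us generalizing e c m with
  | nil =>
    refine ⟨e, ?_⟩
    obtain ⟨⟩ := m
    subst hh hn
    exact (Reach.step (step_next_nil rfl)).mono (by simp)
  | cons u us ih =>
    rw [length_histWord_cons] at hl
    have hlen : (encodeLiteral u).length = (encodeNumber u.1).length + 1 := rfl
    obtain ⟨e₁, h₁⟩ := reach_next (w := w) (a := a) (e := e) (n := n)
      (hh.trans (histWord_cons u us)) hc hn hs hk (by omega) hv
      ((length_encodeNumber_le c).trans (by omega))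
    obtain ⟨e₂, h₂⟩ := ih (e := e₁) (c := if u.1 = v then 0 else c + 1)
      (m := { m with hist := histWord us, past := Sym.sign u.2 :: (encodeNumber u.1 ++ m.past),
                     name := encodeNumber (if u.1 = v then 0 else c + 1) })
      rfl hc rfl hs hk (by split_ifs <;> omega)
    refine ⟨e₂, ?_⟩
    convert (h₁.trans h₂).mono (n' := (u :: us).length * (5 * n + 6) + 1) (by
      rw [List.length_cons]; linarith) using 2
    simp [histWord_cons, scan]

theorem reach_read {e : Bool} (l : List Bool) {u : List Sym} {m : Mem}
    (hi : m.inp = l.map Sym.bit ++ u) (hu : NoBit u) :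
    Reach w a (l.length + 1) (cfg .read e m) (cfg .next e
      { m with inp := u, cur := (l.map Sym.bit).reverse ++ m.cur,
               hist := (l.map Sym.bit).reverse ++ m.hist }) := by
  induction l generalizing m with
  | nil =>
    obtain ⟨⟩ := m
    subst hi
    exact Reach.step (step_read_next hu)
  | cons b l ih =>
    have h := ih (m := { m with
      inp := l.map Sym.bit ++ u, cur := Sym.bit b :: m.cur, hist := Sym.bit b :: m.hist }) rfl
    convert Reach.cons (step_read_bit hi) h using 2 <;> simp

/-- A bound for the time that one literal takes. -/
def literalTime (n : ℕ) : ℕ := n * (5 * n + 6) + 4 * n + 6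

/-- The new name of the variable `v` when the literals `h` have been read. -/
def nameAfter (h : List Literal) (v : ℕ) : ℕ := (h.reverse.map Prod.fst).idxOf v

theorem nameAfter_le (h : List Literal) (v : ℕ) : nameAfter h v ≤ h.length := by
  simpa [nameAfter] using List.idxOf_le_length (a := v) (l := h.reverse.map Prod.fst)

theorem reach_literal {e : Bool} {n : ℕ} {p : Literal} {h : List Literal} {u o c : List Sym}
    (hu : NoBit u) (hn : (histWord h).length + (encodeLiteral p ++ u).length ≤ n) :
    ∃ e', Reach w a (literalTime n)
      (cfg .main e { inp := encodeLiteral p ++ u, out := o, cnt := c, hist := histWord h })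
      (cfg .main e'
        { inp := u, out := (encodeLiteral (nameAfter (p :: h) p.1, p.2)).reverse ++ o, cnt := c,
          hist := histWord (p :: h) }) := by
  have hlen : (encodeLiteral p).length = (encodeNumber p.1).length + 1 := rfl
  rw [List.length_append] at hn
  have hw : (histWord (p :: h)).length ≤ n := by
    rw [length_histWord_cons]
    omega
  have h1 := Reach.cons (w := w) (a := a) (step_main_sign (e := e) (m := {
    inp := encodeLiteral p ++ u, out := o, cnt := c, hist := histWord h }) rfl)
    (reach_read (encodeNat p.1) rfl hu)
  obtain ⟨e₁, h2⟩ := reach_scan (w := w) (a := a) (n := n) (v := p.1) (p :: h) (e := e) (c := 0)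
    (m := { inp := u, out := Sym.sign p.2 :: o, cnt := c, hist := histWord (p :: h),
            cur := (encodeNumber p.1).reverse }) rfl rfl rfl rfl rfl (by omega) (by omega)
  have h3 := reach_move_jump (w := w) (a := a) (e := e₁) (k := .past) (k' := .hist) (by decide)
    (self := .rewind) (after := .clearCur) rfl _
    { inp := u, out := Sym.sign p.2 :: o, cnt := c, past := (histWord (p :: h)).reverse,
      cur := (encodeNumber p.1).reverse, name := encodeNumber (nameAfter (p :: h) p.1) } rfl
  have h4 := reach_clear (w := w) (a := a) (e := e₁) (k := .cur) (self := .clearCur)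
    (after := .emit) rfl _
    { inp := u, out := Sym.sign p.2 :: o, cnt := c, hist := histWord (p :: h),
      cur := (encodeNumber p.1).reverse, name := encodeNumber (nameAfter (p :: h) p.1) } rfl
  have h5 := reach_move_jump (w := w) (a := a) (e := e₁) (k := .name) (k' := .out) (by decide)
    (self := .emit) (after := .main) rfl _
    { inp := u, out := Sym.sign p.2 :: o, cnt := c, hist := histWord (p :: h),
      name := encodeNumber (nameAfter (p :: h) p.1) } rfl
  refine ⟨e₁, ?_⟩
  have h1' : Reach w a ((encodeNat p.1).length + 1 + 1)
      (cfg .main e { inp := encodeLiteral p ++ u, out := o, cnt := c, hist := histWord h })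
      (cfg .next e { inp := u, out := Sym.sign p.2 :: o, cnt := c, hist := histWord (p :: h),
                     cur := (encodeNumber p.1).reverse }) := by
    convert h1 using 2
    simp [histWord_cons, encodeNumber]
  simp only [scan_eq_idxOf, List.append_nil] at h2
  simp only [Mem.set, Mem.get, List.append_nil, List.reverse_reverse, List.length_reverse]
    at h3 h4 h5
  have hall := h1'.trans (h2.trans (h3.trans (h4.trans h5)))
  have hname : (encodeNumber (nameAfter (p :: h) p.1)).length ≤ n :=
    (length_encodeNumber_le _).trans ((nameAfter_le _ _).trans
      ((length_le_length_histWord _).trans hw))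
  have hscan : (p :: h).length * (5 * n + 6) ≤ n * (5 * n + 6) :=
    Nat.mul_le_mul_right _ ((length_le_length_histWord _).trans hw)
  rw [length_encodeNumber] at hlen
  convert hall.mono (n' := literalTime n) (by
    rw [literalTime, length_encodeNumber p.1]
    omega) using 3
  simp [encodeLiteral]

/-- The literals `c` with their new names, when the literals `h` have been read before. -/
def renameLiterals : List Literal → List Literal → List Literal
  | _, [] => []
  | h, p :: c => (nameAfter (p :: h) p.1, p.2) :: renameLiterals (p :: h) c

/-- The clauses `L` with new names, when the literals `h` have been read before. -/
def renameClauses : List Literal → List (List Literal) → List (List Literal)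
  | _, [] => []
  | h, c :: L => renameLiterals h c :: renameClauses (c.reverse ++ h) L

theorem noBit_literals (c : List Literal) {u : List Sym} (hu : NoBit u) :
    NoBit (c.flatMap encodeLiteral ++ u) := by
  cases c with
  | nil => exact hu
  | cons p c => rfl

theorem noBit_clauses (L : List (List Literal)) : NoBit (L.flatMap encodeClause) := by
  cases L <;> rfl

theorem reach_literals {n : ℕ} (c : List Literal) {e : Bool} {h : List Literal} {u o d : List Sym}
    (hu : NoBit u) (hn : (histWord h).length + (c.flatMap encodeLiteral ++ u).length ≤ n) :
    ∃ e', Reach w a (c.length * literalTime n)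
      (cfg .main e { inp := c.flatMap encodeLiteral ++ u, out := o, cnt := d, hist := histWord h })
      (cfg .main e'
        { inp := u, out := ((renameLiterals h c).flatMap encodeLiteral).reverse ++ o, cnt := d,
          hist := histWord (c.reverse ++ h) }) := by
  induction c generalizing e h o with
  | nil => exact ⟨e, Reach.refl _ _⟩
  | cons p c ih =>
    rw [List.flatMap_cons, List.append_assoc] at hn ⊢
    obtain ⟨e₁, h₁⟩ := reach_literal (w := w) (a := a) (e := e) (o := o) (c := d)
      (noBit_literals c hu) hn
    rw [List.length_append] at hn
    obtain ⟨e₂, h₂⟩ := ih (e := e₁) (h := p :: h)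
      (o := (encodeLiteral (nameAfter (p :: h) p.1, p.2)).reverse ++ o) (by
        rw [length_histWord_cons]
        omega)
    refine ⟨e₂, ?_⟩
    convert (h₁.trans h₂).mono (n' := (p :: c).length * literalTime n) (by
      rw [List.length_cons]; linarith) using 3
    · simp [renameLiterals]
    · simp

theorem length_renameLiterals {n : ℕ} (h c : List Literal) (hn : h.length + c.length ≤ n) :
    ((renameLiterals h c).flatMap encodeLiteral).length ≤ c.length * (n + 1) := by
  induction c generalizing h with
  | nil => simp [renameLiterals]
  | cons p c ih =>
    rw [List.length_cons] at hn ⊢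
    have h1 := ih (p :: h) (by rw [List.length_cons]; omega)
    have h2 : (encodeLiteral (nameAfter (p :: h) p.1, p.2)).length ≤ n + 1 := by
      rw [encodeLiteral, List.length_cons]
      have h3 := length_encodeNumber_le (nameAfter (p :: h) p.1)
      have h4 := nameAfter_le (p :: h) p.1
      rw [List.length_cons] at h4
      simp only
      omega
    rw [renameLiterals, List.flatMap_cons, List.length_append]
    linarith

theorem length_le_length_literals (c : List Literal) :
    c.length ≤ (c.flatMap encodeLiteral).length := by
  induction c with
  | nil => simp
  | cons p c ih =>
    rw [List.flatMap_cons, List.length_append, encodeLiteral, List.length_cons, List.length_cons]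
    omega

theorem length_histWord_append (h h' : List Literal) :
    (histWord (h ++ h')).length = (histWord h).length + (histWord h').length := by
  simp [histWord]

theorem length_histWord_reverse (c : List Literal) :
    (histWord c.reverse).length = (c.flatMap encodeLiteral).length := by
  induction c with
  | nil => rfl
  | cons p c ih =>
    rw [List.reverse_cons, length_histWord_append, ih, length_histWord_cons, List.flatMap_cons,
      List.length_append]
    simp [histWord]
    omega

/-- A bound for the time that each symbol of the clauses takes. -/
def symbolTime (w n : ℕ) : ℕ := literalTime n + 2 * (w + 2 * n) + 3

/-- All clauses are read, if there are fewer than `2 ^ t`. -/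
theorem reach_clauses {n t : ℕ} (ht : t ≤ w + 2 * n) (L : List (List Literal)) {e : Bool} {x : ℕ}
    {h : List Literal} {o : List Sym} (hx : x + L.length < 2 ^ t)
    (hn : (histWord h).length + (L.flatMap encodeClause).length ≤ n) :
    ∃ e', Reach w a ((L.flatMap encodeClause).length * symbolTime w n)
      (cfg .main e { inp := L.flatMap encodeClause, out := o,
                     cnt := (fixedBits t x).map Sym.bit, hist := histWord h })
      (cfg .main e'
        { out := ((renameClauses h L).flatMap encodeClause).reverse ++ o,
          cnt := (fixedBits t (x + L.length)).map Sym.bit,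
          hist := histWord (L.flatten.reverse ++ h) }) := by
  induction L generalizing e x h o with
  | nil => exact ⟨e, Reach.refl _ _⟩
  | cons c L ih =>
    rw [List.length_cons] at hx
    simp only [List.flatMap_cons, List.length_append] at hn
    have hlen : (encodeClause c).length = (c.flatMap encodeLiteral).length + 1 := rfl
    have h1 := Reach.cons (w := w) (a := a) (step_main_clause (e := e) (m := {
        inp := (c :: L).flatMap encodeClause, out := o, cnt := (fixedBits t x).map Sym.bit,
        hist := histWord h }) rfl)
      (reach_count (t := t) (x := x) (k := 0) rfl rfl (by omega))
    obtain ⟨e₁, h2⟩ := reach_literals (w := w) (a := a) (n := n) c (e := e) (h := h)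
      (u := L.flatMap encodeClause) (o := Sym.clause :: o)
      (d := (fixedBits t (x + 1)).map Sym.bit) (noBit_clauses L) (by
        rw [List.length_append]
        omega)
    obtain ⟨e₂, h3⟩ := ih (e := e₁) (x := x + 1) (h := c.reverse ++ h)
      (o := ((renameLiterals h c).flatMap encodeLiteral).reverse ++ Sym.clause :: o) (by omega) (by
        rw [length_histWord_append, length_histWord_reverse]
        omega)
    refine ⟨e₂, ?_⟩
    have h4 := h1.trans (h2.trans h3)
    have htime : 2 * t + 0 + 2 + 1 + (c.length * literalTime n
        + (L.flatMap encodeClause).length * symbolTime w n)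
        ≤ ((c :: L).flatMap encodeClause).length * symbolTime w n := by
      have e1 : c.length * literalTime n ≤ (c.flatMap encodeLiteral).length * symbolTime w n :=
        Nat.mul_le_mul (length_le_length_literals c) (by rw [symbolTime]; omega)
      have e2 : 2 * t + 3 ≤ symbolTime w n := by
        rw [symbolTime]
        omega
      rw [List.flatMap_cons, List.length_append, hlen]
      linarith
    convert h4.mono htime using 3
    · simp [renameClauses, encodeClause]
    · rw [List.length_cons]
      congr 2
      omega
    · simp

/-- If there are at least `2 ^ t` clauses, then the clause counter overflows. -/
theorem reach_overflow {n t : ℕ} (ht : t ≤ w + 2 * n) (L : List (List Literal)) {e : Bool} {x : ℕ}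
    {h : List Literal} {o : List Sym} (hx : x < 2 ^ t) (hx' : 2 ^ t ≤ x + L.length)
    (hn : (histWord h).length + (L.flatMap encodeClause).length ≤ n) :
    ∃ e' i o' h', i.length ≤ n ∧ (histWord h').length ≤ n ∧
      o'.length ≤ o.length + (L.flatMap encodeClause).length * (n + 1) ∧
      Reach w a ((L.flatMap encodeClause).length * symbolTime w n)
      (cfg .main e { inp := L.flatMap encodeClause, out := o,
                     cnt := (fixedBits t x).map Sym.bit, hist := histWord h })
      (cfg .wipeInp e'
        { inp := i, out := o', hist := histWord h',
          carry := List.replicate t (Sym.bit false) }) := by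
  induction L generalizing e x h o with
  | nil =>
    rw [List.length_nil] at hx'
    omega
  | cons c L ih =>
    rw [List.length_cons] at hx'
    simp only [List.flatMap_cons, List.length_append] at hn ⊢
    have hlen : (encodeClause c).length = (c.flatMap encodeLiteral).length + 1 := rfl
    have h0 := step_main_clause (w := w) (a := a) (e := e) (m := {
      inp := (c :: L).flatMap encodeClause, out := o, cnt := (fixedBits t x).map Sym.bit,
      hist := histWord h }) rfl
    have e2 : 2 * t + 3 ≤ symbolTime w n := by
      rw [symbolTime]
      omega
    by_cases hov : x + 1 = 2 ^ t
    · have h1 := Reach.cons h0 (reach_count_overflow (t := t) (x := x) (k := 0) rfl rfl hov)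
      rw [zero_add] at h1
      refine ⟨e, c.flatMap encodeLiteral ++ L.flatMap encodeClause, Sym.clause :: o, h, ?_, ?_, ?_,
        h1.mono ?_⟩
      · rw [List.length_append]
        omega
      · omega
      · rw [List.length_cons, hlen]
        nlinarith
      · rw [hlen]
        nlinarith
    · have h1 := Reach.cons h0 (reach_count (t := t) (x := x) (k := 0) rfl rfl (by omega))
      obtain ⟨e₁, h2⟩ := reach_literals (w := w) (a := a) (n := n) c (e := e) (h := h)
        (u := L.flatMap encodeClause) (o := Sym.clause :: o)
        (d := (fixedBits t (x + 1)).map Sym.bit) (noBit_clauses L) (by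
          rw [List.length_append]
          omega)
      obtain ⟨e₂, i, o', h', hi, hh', ho', h3⟩ := ih (e := e₁) (x := x + 1) (h := c.reverse ++ h)
        (o := ((renameLiterals h c).flatMap encodeLiteral).reverse ++ Sym.clause :: o)
        (by omega) (by omega) (by
          rw [length_histWord_append, length_histWord_reverse]
          omega)
      have hc := length_le_length_literals c
      refine ⟨e₂, i, o', h', hi, hh', ?_, (h1.trans (h2.trans h3)).mono ?_⟩
      · have h4 := length_renameLiterals (n := n) h c (by
          have := length_le_length_histWord h
          omega)
        have h5 : c.length * (n + 1) ≤ (c.flatMap encodeLiteral).length * (n + 1) :=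
          Nat.mul_le_mul_right _ hc
        rw [List.length_append, List.length_reverse, List.length_cons] at ho'
        rw [hlen]
        nlinarith
      · have e1 : c.length * literalTime n ≤ (c.flatMap encodeLiteral).length * symbolTime w n :=
          Nat.mul_le_mul hc (by rw [symbolTime]; omega)
        rw [hlen]
        linarith

theorem length_renameClauses {n : ℕ} (h : List Literal) (L : List (List Literal))
    (hn : h.length + (L.flatMap encodeClause).length ≤ n) :
    ((renameClauses h L).flatMap encodeClause).length
      ≤ (L.flatMap encodeClause).length * (n + 1) := by
  induction L generalizing h with
  | nil => simp [renameClauses]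
  | cons c L ih =>
    have hc := length_le_length_literals c
    simp only [renameClauses, List.flatMap_cons, List.length_append, encodeClause,
      List.length_cons] at hn ⊢
    have h1 := ih (c.reverse ++ h) (by
      rw [List.length_append, List.length_reverse]
      omega)
    have h2 := length_renameLiterals (n := n) h c (by omega)
    have h3 : c.length * (n + 1) ≤ (c.flatMap encodeLiteral).length * (n + 1) :=
      Nat.mul_le_mul_right _ hc
    nlinarith

/-- The number in front of the clauses is copied, and makes the counter two digits wider for each
of its digits. -/
theorem reach_num {e : Bool} (l : List Bool) {u : List Sym} {m : Mem} {k : ℕ}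
    (hi : m.inp = l.map Sym.bit ++ u) (hc : m.cnt = List.replicate k (Sym.bit false))
    (hu : NoBit u) :
    Reach w a (l.length + 1) (cfg .num e m) (cfg .main e
      { m with inp := u, out := (l.map Sym.bit).reverse ++ m.out,
               cnt := List.replicate (k + 2 * l.length) (Sym.bit false) }) := by
  induction l generalizing m k with
  | nil =>
    obtain ⟨⟩ := m
    subst hi hc
    exact Reach.step (step_num_main hu)
  | cons b l ih =>
    have h := ih (k := k + 2) (m := { m with
      inp := l.map Sym.bit ++ u, out := Sym.bit b :: m.out,
      cnt := Sym.bit false :: Sym.bit false :: m.cnt }) rfl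
      (by rw [hc, List.replicate_succ, List.replicate_succ])
    convert Reach.cons (step_num_bit hi) h using 3
    · rfl
    · simp
    · rw [List.length_cons]
      congr 1
      omega

/-- A bound for the running time of the machine. -/
def runTime (w n : ℕ) : ℕ := n * symbolTime w n + n * (n + 1) + 10 * n + 3 * w + 10

/-- What the machine does with a number and a list of clauses. -/
theorem reach_halted (num : ℕ) (L : List (List Literal)) {n : ℕ}
    (hn : n = (encodeNumber num ++ L.flatMap encodeClause).length) :
    Reach w a (runTime w n)
      (cfg .start false { inp := encodeNumber num ++ L.flatMap encodeClause })
      (halted { inp :=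
        if L.length < 2 ^ (w + 2 * (encodeNat num).length)
        then encodeNumber num ++ (renameClauses [] L).flatMap encodeClause else a }) := by
  set t := w + 2 * (encodeNat num).length with ht
  have h1 := Reach.cons (w := w) (a := a) (step_start (e := false) (m := {
      inp := encodeNumber num ++ L.flatMap encodeClause }))
    (reach_num (encodeNat num) (k := w) rfl (List.append_nil _) (noBit_clauses L))
  rw [← ht] at h1
  rw [List.length_append, length_encodeNumber] at hn
  have hcnt : List.replicate t (Sym.bit false) = (fixedBits t 0).map Sym.bit := by
    rw [fixedBits_zero, List.map_replicate]
  have hlen0 : (histWord []).length = 0 := rfl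
  have hnum : ((encodeNat num).map Sym.bit).reverse = (encodeNumber num).reverse := rfl
  have hnumlen : (encodeNumber num).reverse.length = (encodeNat num).length := by
    rw [List.length_reverse, length_encodeNumber]
  simp only [hcnt, hnum, List.append_nil] at h1
  have htime : (L.flatMap encodeClause).length * symbolTime w n ≤ n * symbolTime w n :=
    Nat.mul_le_mul_right _ (by omega)
  have hmul : (L.flatMap encodeClause).length * (n + 1) ≤ n * (n + 1) :=
    Nat.mul_le_mul_right _ (by omega)
  by_cases hL : L.length < 2 ^ t
  · obtain ⟨e, h2⟩ := reach_clauses (w := w) (a := a) (n := n) (t := t) (by omega) L (e := false)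
      (x := 0) (h := []) (o := (encodeNumber num).reverse) (by omega) (by omega)
    have hout := length_renameClauses (n := n) [] L (by rw [List.length_nil]; omega)
    have hhist : (histWord (L.flatten.reverse ++ [])).length ≤ n := by
      rw [List.append_nil, length_histWord_reverse]
      have : ∀ L : List (List Literal),
          (L.flatten.flatMap encodeLiteral).length ≤ (L.flatMap encodeClause).length := by
        intro L
        induction L with
        | nil => simp
        | cons c L ih =>
          simp only [List.flatten_cons, List.flatMap_append, List.length_append,
            List.flatMap_cons, encodeClause, List.length_cons]
          omega
      have := this L
      omega
    set o := ((renameClauses [] L).flatMap encodeClause).reverse ++ (encodeNumber num).reverse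
      with ho
    have holen : o.length ≤ n * (n + 1) + n := by
      rw [ho, List.length_append, List.length_reverse, hnumlen]
      omega
    rw [zero_add] at h2
    have h3 := h1.trans (h2.trans (Reach.step (step_main_nil rfl)))
    have h4 := h3.trans (reach_clear (k := .cnt) (self := .clearCnt) (after := .clearHist) rfl _ _
      rfl)
    have h5 := h4.trans (reach_clear (k := .hist) (self := .clearHist) (after := .deliver) rfl _ _
      rfl)
    have h6 := h5.trans (reach_move (k := .out) (k' := .inp) (by decide) (self := .deliver) rfl _ _
      rfl)
    have h7 := h6.trans (Reach.step (step_deliver_nil rfl))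
    convert h7.mono (n' := runTime w n) ?_ using 2
    · rw [if_pos hL]
      simp [Mem.set, Mem.get, ho]
    · simp only [Mem.set, Mem.get, List.length_map, length_fixedBits, runTime]
      omega
  · obtain ⟨e, i, o, h, hi, hh, ho, h2⟩ := reach_overflow (w := w) (a := a) (n := n) (t := t)
      (by omega) L (e := false) (x := 0) (h := []) (o := (encodeNumber num).reverse)
      (by positivity) (by omega) (by omega)
    have h3 := h1.trans (h2.trans (reach_clear (k := .inp) (self := .wipeInp) (after := .wipeOut)
      rfl _ _ rfl))
    have h4 := h3.trans (reach_clear (k := .out) (self := .wipeOut) (after := .wipeHist) rfl _ _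
      rfl)
    have h5 := h4.trans (reach_clear (k := .hist) (self := .wipeHist) (after := .wipeCarry) rfl _ _
      rfl)
    have h6 := h5.trans (reach_clear (k := .carry) (self := .wipeCarry) (after := .answer) rfl _ _
      rfl)
    have h7 := h6.trans (Reach.step (step_answer rfl))
    convert h7.mono (n' := runTime w n) ?_ using 2
    · rw [if_neg hL]
      rfl
    · rw [hnumlen] at ho
      simp only [Mem.set, Mem.get, List.length_replicate, runTime]
      omega

end Runs

/-! ### Renaming variables -/

/-- Rename the variable of a literal. -/
def Literal.rename (ρ : ℕ → ℕ) (p : Literal) : Literal := (ρ p.1, p.2)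

theorem Literal.rename_injective {ρ : ℕ → ℕ} (hρ : Function.Injective ρ) :
    Function.Injective (Literal.rename ρ) := fun p q h => by
  rw [Literal.rename, Literal.rename, Prod.mk.injEq] at h
  exact Prod.ext (hρ h.1) h.2

theorem Literal.neg_rename (ρ : ℕ → ℕ) (p : Literal) : (p.rename ρ).neg = p.neg.rename ρ := rfl

/-- Rename the variables of a clause. -/
def Clause.rename (ρ : ℕ → ℕ) (Y : Clause) : Clause := Finset.image (Literal.rename ρ) Y

theorem Clause.rename_injective {ρ : ℕ → ℕ} (hρ : Function.Injective ρ) :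
    Function.Injective (Clause.rename ρ) :=
  Finset.image_injective (Literal.rename_injective hρ)

theorem Clause.rename_mem_iff {ρ : ℕ → ℕ} (hρ : Function.Injective ρ) {p : Literal} {Y : Clause} :
    p.rename ρ ∈ Clause.rename ρ Y ↔ p ∈ Y := by
  rw [Clause.rename, (Literal.rename_injective hρ).mem_finset_image]

theorem Clause.exists_mem_rename {ρ : ℕ → ℕ} {Y : Clause} {P : Literal → Prop} :
    (∃ p ∈ Clause.rename ρ Y, P p) ↔ ∃ p ∈ Y, P (p.rename ρ) := by
  simp only [Clause.rename, Finset.mem_image]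
  constructor
  · rintro ⟨_, ⟨p, hp, rfl⟩, h⟩
    exact ⟨p, hp, h⟩
  · rintro ⟨p, hp, h⟩
    exact ⟨_, ⟨p, hp, rfl⟩, h⟩

theorem conflict_rename {ρ : ℕ → ℕ} (hρ : Function.Injective ρ) {Y Z : Clause} :
    Conflict (Clause.rename ρ Y) (Clause.rename ρ Z) ↔ Conflict Y Z := by
  simp only [Conflict, Clause.exists_mem_rename, Literal.neg_rename, Clause.rename_mem_iff hρ]

theorem overlap_rename {ρ : ℕ → ℕ} (hρ : Function.Injective ρ) {Y Z : Clause} :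
    Overlap (Clause.rename ρ Y) (Clause.rename ρ Z) ↔ Overlap Y Z := by
  simp only [Overlap, conflict_rename hρ, Clause.exists_mem_rename, Clause.rename_mem_iff hρ]

theorem satisfies_rename {ρ : ℕ → ℕ} {τ : ℕ → Bool} {Y : Clause} :
    Satisfies τ (Clause.rename ρ Y) ↔ Satisfies (τ ∘ ρ) Y := by
  simp only [Satisfies, Clause.exists_mem_rename]
  rfl

/-- Rename the variables of a formula. -/
def Formula.rename (ρ : ℕ → ℕ) (C : Formula) : Formula := Finset.image (Clause.rename ρ) C

theorem Formula.card_rename {ρ : ℕ → ℕ} (hρ : Function.Injective ρ) (C : Formula) :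
    (Formula.rename ρ C).card = C.card :=
  Finset.card_image_of_injective _ (Clause.rename_injective hρ)

theorem isExactCNF_rename {r : ℕ} {ρ : ℕ → ℕ} (hρ : Function.Injective ρ) {C : Formula}
    (hC : IsExactCNF r C) : IsExactCNF r (Formula.rename ρ C) := by
  intro Y' hY'
  obtain ⟨Y, hY, rfl⟩ := Finset.mem_image.1 hY'
  refine ⟨?_, ?_⟩
  · rw [Clause.rename, Finset.card_image_of_injective _ (Literal.rename_injective hρ), (hC Y hY).1]
  · intro p' hp'
    obtain ⟨p, hp, rfl⟩ := Finset.mem_image.1 hp'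
    rw [Literal.neg_rename, Clause.rename_mem_iff hρ]
    exact (hC Y hY).2 p hp

theorem numSatisfied_rename {ρ : ℕ → ℕ} (hρ : Function.Injective ρ) (τ : ℕ → Bool) (C : Formula) :
    numSatisfied τ (Formula.rename ρ C) = numSatisfied (τ ∘ ρ) C := by
  classical
  rw [numSatisfied, numSatisfied, Formula.rename, Finset.filter_image,
    Finset.card_image_of_injective _ (Clause.rename_injective hρ)]
  simp only [satisfies_rename]

open Classical in
theorem card_filter_offDiag_rename {ρ : ℕ → ℕ} (hρ : Function.Injective ρ) (C : Formula)
    {R : Clause → Clause → Prop}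
    (hR : ∀ Y Z, R (Clause.rename ρ Y) (Clause.rename ρ Z) ↔ R Y Z) :
    ((Formula.rename ρ C).offDiag.filter fun P => R P.1 P.2).card
      = (C.offDiag.filter fun P => R P.1 P.2).card := by
  have hinj := Clause.rename_injective hρ
  rw [← Finset.card_image_of_injective (C.offDiag.filter fun P => R P.1 P.2)
    (hinj.prodMap hinj)]
  congr 1
  ext ⟨Y, Z⟩
  simp only [Formula.rename, Finset.mem_filter, Finset.mem_offDiag, Finset.mem_image, Prod.exists,
    Prod.map_apply, Prod.mk.injEq]
  constructor
  · rintro ⟨⟨⟨Y, hY, rfl⟩, ⟨Z, hZ, rfl⟩, hne⟩, h⟩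
    exact ⟨Y, Z, ⟨⟨hY, hZ, fun e => hne (e ▸ rfl)⟩, (hR Y Z).1 h⟩, rfl, rfl⟩
  · rintro ⟨Y, Z, ⟨⟨hY, hZ, hne⟩, h⟩, rfl, rfl⟩
    exact ⟨⟨⟨Y, hY, rfl⟩, ⟨Z, hZ, rfl⟩, fun e => hne (hinj e)⟩, (hR Y Z).2 h⟩

theorem conflictNumber_rename {ρ : ℕ → ℕ} (hρ : Function.Injective ρ) (C : Formula) :
    conflictNumber (Formula.rename ρ C) = conflictNumber C := by
  rw [conflictNumber, conflictNumber,
    card_filter_offDiag_rename hρ C fun _ _ => conflict_rename hρ,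
    card_filter_offDiag_rename hρ C fun _ _ => overlap_rename hρ]

theorem toFinset_map_rename (ρ : ℕ → ℕ) (c : List Literal) :
    (c.map (Literal.rename ρ)).toFinset = Clause.rename ρ c.toFinset := by
  ext p
  simp [Clause.rename]

theorem map_toFinset_map_rename (ρ : ℕ → ℕ) (L : List (List Literal)) :
    (L.map (List.map (Literal.rename ρ))).map List.toFinset
      = (L.map List.toFinset).map (Clause.rename ρ) := by
  simp [toFinset_map_rename]

theorem toFinset_clauses_rename (ρ : ℕ → ℕ) (L : List (List Literal)) :
    ((L.map (List.map (Literal.rename ρ))).map List.toFinset).toFinset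
      = Formula.rename ρ (L.map List.toFinset).toFinset := by
  rw [map_toFinset_map_rename]
  ext Y
  simp [Formula.rename]

/-- Rename the variables of an instance. -/
def SatInstance.rename {r : ℕ} (I : SatInstance r) (ρ : ℕ → ℕ) (hρ : Function.Injective ρ) :
    SatInstance r where
  clauses := I.clauses.map (List.map (Literal.rename ρ))
  num := I.num
  literals_nodup := by
    intro c hc
    obtain ⟨c', hc', rfl⟩ := List.mem_map.1 hc
    exact (I.literals_nodup c' hc').map (Literal.rename_injective hρ)
  clauses_nodup := by
    rw [map_toFinset_map_rename]
    exact I.clauses_nodup.map (Clause.rename_injective hρ)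
  isExactCNF := by
    rw [toFinset_clauses_rename]
    exact isExactCNF_rename hρ I.isExactCNF
  num_pos := I.num_pos

namespace SatInstance

variable {r : ℕ} (I : SatInstance r) {ρ : ℕ → ℕ} (hρ : Function.Injective ρ)

theorem formula_rename : (I.rename ρ hρ).formula = Formula.rename ρ I.formula :=
  toFinset_clauses_rename ρ I.clauses

theorem isYes_rename : (I.rename ρ hρ).IsYes ↔ I.IsYes := by
  have hk : (I.rename ρ hρ).k = I.k := rfl
  simp only [IsYes, formula_rename, Formula.card_rename hρ, numSatisfied_rename hρ, hk]
  constructor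
  · rintro ⟨τ, h⟩
    exact ⟨_, h⟩
  · rintro ⟨τ, h⟩
    refine ⟨τ ∘ Function.invFun ρ, ?_⟩
    rwa [Function.comp_assoc, Function.invFun_comp hρ, Function.comp_id]

theorem lowConflict_rename (h : LowConflict r I) : LowConflict r (I.rename ρ hρ) := by
  rw [LowConflict, formula_rename, conflictNumber_rename hρ, Formula.card_rename hρ]
  exact h

theorem card_formula : I.formula.card = I.clauses.length := by
  rw [formula, List.toFinset_card_of_nodup I.clauses_nodup, List.length_map]

theorem length_clause {c : List Literal} (hc : c ∈ I.clauses) : c.length = r := by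
  rw [← List.toFinset_card_of_nodup (I.literals_nodup c hc)]
  exact (I.isExactCNF _ (List.mem_toFinset.2 (List.mem_map_of_mem hc))).1

/-- The variables of all literals of an instance, in the order in which they are written. -/
def vars : List ℕ := I.clauses.flatten.map Prod.fst

theorem length_vars : I.vars.length = r * I.clauses.length := by
  have : I.clauses.map List.length = List.replicate I.clauses.length r :=
    List.eq_replicate_iff.2 ⟨List.length_map .., fun n hn => by
      obtain ⟨c, hc, rfl⟩ := List.mem_map.1 hn
      exact I.length_clause hc⟩
  rw [vars, List.length_map, List.length_flatten, this, List.sum_replicate, smul_eq_mul, mul_comm]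

/-- The position of the first occurrence of a variable; the variables that do not occur are moved
out of the way, so that the map is injective. -/
def position (v : ℕ) : ℕ := if v ∈ I.vars then I.vars.idxOf v else I.vars.length + v

theorem position_injective : Function.Injective I.position := by
  intro u v h
  rw [position, position] at h
  split_ifs at h with hu hv hv
  · exact (List.idxOf_inj hu).1 h
  · have := List.idxOf_lt_length_iff.2 hu
    omega
  · have := List.idxOf_lt_length_iff.2 hv
    omega
  · omega

/-- The instance in which each variable is replaced by the position of its first occurrence. -/
def normalize : SatInstance r := I.rename I.position I.position_injective

theorem fst_mem_vars {c : List Literal} (hc : c ∈ I.clauses) {p : Literal} (hp : p ∈ c) :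
    p.1 ∈ I.vars :=
  List.mem_map_of_mem (List.mem_flatten.2 ⟨c, hc, hp⟩)

theorem fst_lt_of_mem_normalize {c : List Literal} (hc : c ∈ I.normalize.clauses) {p : Literal}
    (hp : p ∈ c) : p.1 < r * I.clauses.length := by
  obtain ⟨c', hc', rfl⟩ := List.mem_map.1 hc
  obtain ⟨q, hq, rfl⟩ := List.mem_map.1 hp
  have hv := I.fst_mem_vars hc' hq
  rw [← length_vars]
  simp only [Literal.rename, position, if_pos hv]
  exact List.idxOf_lt_length_iff.2 hv

end SatInstance

/-- A variable that occurs already in the literals read so far keeps its position, whatever is read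
later. -/
theorem renameLiterals_eq (h c s : List Literal) :
    renameLiterals h c
      = c.map (Literal.rename ((h.reverse ++ c ++ s).map Prod.fst).idxOf) := by
  induction c generalizing h with
  | nil => rfl
  | cons p c ih =>
    rw [renameLiterals, ih (p :: h), List.map_cons]
    have e : (p :: h).reverse ++ c ++ s = h.reverse ++ p :: c ++ s := by simp
    rw [e]
    congr 1
    rw [Literal.rename, nameAfter, ← e, List.append_assoc, List.map_append (l₁ := (p :: h).reverse),
      List.idxOf_append_of_mem]
    simp

theorem renameClauses_eq (h : List Literal) (L : List (List Literal)) :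
    renameClauses h L
      = L.map (List.map (Literal.rename ((h.reverse ++ L.flatten).map Prod.fst).idxOf)) := by
  induction L generalizing h with
  | nil => rfl
  | cons c L ih =>
    rw [renameClauses, ih, renameLiterals_eq h c L.flatten, List.map_cons]
    simp

theorem SatInstance.normalize_clauses {r : ℕ} (I : SatInstance r) :
    I.normalize.clauses = renameClauses [] I.clauses := by
  rw [renameClauses_eq]
  refine List.map_congr_left fun c hc => List.map_congr_left fun p hp => ?_
  simp only [Literal.rename, SatInstance.position, if_pos (I.fst_mem_vars hc hp)]
  rfl

/-! ### The kernel -/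

/-- The yes-instance with the single clause `x_0 ∨ ⋯ ∨ x_{r-1}` and parameter `1 / 2 ^ r`. -/
def singleClause (r : ℕ) : SatInstance r where
  clauses := [(List.range r).map fun i => (i, true)]
  num := 1
  literals_nodup := by
    intro c hc
    rw [List.mem_singleton.1 hc]
    exact List.nodup_range.map fun i j h => (Prod.mk.inj h).1
  clauses_nodup := by simp
  isExactCNF := by
    intro Y hY
    simp only [List.map_cons, List.map_nil, List.toFinset_cons, List.toFinset_nil,
      insert_empty_eq, Finset.mem_singleton] at hY
    subst hY
    refine ⟨?_, ?_⟩
    · rw [List.toFinset_card_of_nodup, List.length_map, List.length_range]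
      exact List.nodup_range.map fun i j h => (Prod.mk.inj h).1
    · intro p hp hn
      simp only [List.mem_toFinset, List.mem_map, Literal.neg] at hp hn
      obtain ⟨i, -, rfl⟩ := hp
      obtain ⟨j, -, h⟩ := hn
      simp at h
  num_pos := one_pos

theorem singleClause_card (r : ℕ) : (singleClause r).formula.card = 1 := by
  rw [SatInstance.card_formula]
  rfl

theorem singleClause_isYes {r : ℕ} (hr : 0 < r) : (singleClause r).IsYes := by
  classical
  refine ⟨fun _ => true, ?_⟩
  have h : numSatisfied (fun _ => true) (singleClause r).formula = 1 := by
    rw [numSatisfied, Finset.filter_true_of_mem, singleClause_card]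
    intro Y hY
    simp only [SatInstance.formula, singleClause, List.map_cons, List.map_nil, List.toFinset_cons,
      List.toFinset_nil, insert_empty_eq, Finset.mem_singleton] at hY
    subst hY
    exact ⟨(0, true), by simpa using hr, rfl⟩
  rw [h, singleClause_card, SatInstance.k, singleClause]
  simp

theorem singleClause_lowConflict {r : ℕ} (hr : 0 < r) : LowConflict r (singleClause r) := by
  obtain ⟨Y, hY⟩ := Finset.card_eq_one.1 (singleClause_card r)
  have h2 : (2 : ℤ) ≤ 2 ^ r := by
    calc (2 : ℤ) = 2 ^ 1 := rfl
      _ ≤ 2 ^ r := pow_le_pow_right₀ (by norm_num) hr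
  rw [LowConflict, hY, conflictNumber]
  simpa using h2

/-- The binary logarithm of a number of clauses from which on the answer is certainly yes. It
depends on the parameter only through its number of digits, which makes it easy to compute. -/
def threshold {r : ℕ} (I : SatInstance r) : ℕ := 4 * r + 2 + 2 * (encodeNat I.num).length

theorem two_pow_threshold_bounds {r : ℕ} (I : SatInstance r) :
    4 * 16 ^ r * I.num ^ 2 ≤ 2 ^ threshold I ∧ 2 ^ threshold I ≤ 16 * 16 ^ r * I.num ^ 2 := by
  obtain ⟨h1, h2⟩ := encodeNat_bounds I.num_pos
  have e : 2 ^ threshold I = 4 * 16 ^ r * (2 ^ (encodeNat I.num).length) ^ 2 := by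
    rw [threshold, pow_add, pow_add, pow_mul, mul_comm 2 (encodeNat I.num).length, pow_mul]
    norm_num
    ring
  rw [e]
  constructor
  · gcongr
  · calc 4 * 16 ^ r * (2 ^ (encodeNat I.num).length) ^ 2 ≤ 4 * 16 ^ r * (2 * I.num) ^ 2 := by
          gcongr
      _ = 16 * 16 ^ r * I.num ^ 2 := by ring

/-- The kernel: with many clauses, a fixed yes-instance; otherwise only the variables are
renamed. -/
def kernel (r : ℕ) (I : SatInstance r) : SatInstance r :=
  if I.clauses.length < 2 ^ threshold I then I.normalize else singleClause r

theorem kernel_lowConflict {r : ℕ} (hr : 0 < r) {I : SatInstance r} (h : LowConflict r I) :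
    LowConflict r (kernel r I) := by
  rw [kernel]
  split_ifs
  · exact I.lowConflict_rename _ h
  · exact singleClause_lowConflict hr

theorem kernel_isYes {r : ℕ} (hr : 0 < r) {I : SatInstance r} (h : LowConflict r I) :
    (kernel r I).IsYes ↔ I.IsYes := by
  rw [kernel]
  split_ifs with hm
  · exact I.isYes_rename _
  · refine iff_of_true (singleClause_isYes hr) ?_
    rw [not_lt, ← SatInstance.card_formula] at hm
    exact exists_numSatisfied_ge I.isExactCNF h I.num_pos hr
      ((two_pow_threshold_bounds I).1.trans hm)

theorem kernel_k_le {r : ℕ} (I : SatInstance r) : (kernel r I).k ≤ I.k := by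
  rw [kernel]
  split_ifs
  · exact le_rfl
  · have : (1 : ℚ) ≤ I.num := by exact_mod_cast I.num_pos
    rw [SatInstance.k, SatInstance.k, singleClause]
    gcongr
    exact_mod_cast I.num_pos

theorem kernel_card_lt {r : ℕ} (I : SatInstance r) :
    ((kernel r I).formula.card : ℚ) < 16 * 256 ^ r * I.k ^ 2 := by
  have hk : 16 * 256 ^ r * I.k ^ 2 = ((16 * 64 ^ r * I.num ^ 2 : ℕ) : ℚ) := by
    have h256 : (256 : ℚ) ^ r = 64 ^ r * (2 ^ r) ^ 2 := by
      rw [← pow_mul, mul_comm r 2, pow_mul, ← mul_pow]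
      norm_num
    rw [SatInstance.k, div_pow, h256]
    push_cast
    field_simp
  rw [hk, Nat.cast_lt]
  have hpos := I.num_pos
  rw [kernel]
  split_ifs with hm
  · rw [SatInstance.normalize, SatInstance.formula_rename,
      Formula.card_rename I.position_injective, SatInstance.card_formula]
    refine (hm.trans_le (two_pow_threshold_bounds I).2).trans_le ?_
    gcongr
    norm_num
  · rw [singleClause_card]
    have h1 : 0 < 64 ^ r * I.num ^ 2 := by positivity
    rw [mul_assoc]
    omega

theorem kernel_fst_lt {r : ℕ} (I : SatInstance r) :
    ∀ Y ∈ (kernel r I).formula, ∀ p ∈ Y, p.1 < r * (kernel r I).formula.card := by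
  intro Y hY p hp
  obtain ⟨c, hc, rfl⟩ := List.mem_map.1 (List.mem_toFinset.1 hY)
  rw [List.mem_toFinset] at hp
  rw [kernel] at hc ⊢
  split_ifs at hc ⊢
  · rw [SatInstance.normalize, SatInstance.formula_rename,
      Formula.card_rename I.position_injective, SatInstance.card_formula]
    exact I.fst_lt_of_mem_normalize hc hp
  · rw [singleClause_card, mul_one]
    rw [singleClause, List.mem_singleton] at hc
    subst hc
    obtain ⟨i, hi, rfl⟩ := List.mem_map.1 hp
    exact List.mem_range.1 hi

theorem length_flatMap_le {α β : Type*} (f : α → List β) (l : List α) {b : ℕ}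
    (h : ∀ x ∈ l, (f x).length ≤ b) : (l.flatMap f).length ≤ l.length * b := by
  induction l with
  | nil => simp
  | cons x l ih =>
    have h1 := ih fun y hy => h y (List.mem_cons_of_mem _ hy)
    have h2 := h x List.mem_cons_self
    rw [List.flatMap_cons, List.length_append, List.length_cons]
    linarith

theorem kernel_size_le (r : ℕ) :
    ∃ g : ℚ → ℕ, ∀ I : SatInstance r, (kernel r I).encode.length ≤ g I.k := by
  refine ⟨fun q => max (singleClause r).encode.length
    ((q * 2 ^ r).num.toNat + 2 ^ (4 * r + 2 + 2 * (encodeNat (q * 2 ^ r).num.toNat).length)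
      * (r * (r * 2 ^ (4 * r + 2 + 2 * (encodeNat (q * 2 ^ r).num.toNat).length) + 1) + 1)),
    fun I => ?_⟩
  have hnum : (I.k * 2 ^ r).num.toNat = I.num := by
    rw [SatInstance.k, div_mul_cancel₀ _ (by positivity)]
    simp
  simp only [hnum]
  rw [← threshold, kernel]
  split_ifs with hm
  · refine le_max_of_le_right ?_
    rw [SatInstance.encode, List.length_append]
    refine add_le_add (length_encodeNumber_le _) ?_
    have hlen : I.normalize.clauses.length = I.clauses.length := List.length_map ..
    refine (length_flatMap_le (b := r * (r * 2 ^ threshold I + 1) + 1) _ _ fun c hc => ?_).trans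
      (Nat.mul_le_mul_right _ (hlen ▸ hm.le))
    have h := length_flatMap_le (b := r * 2 ^ threshold I + 1) encodeLiteral c fun p hp =>
      Nat.succ_le_succ ((length_encodeNumber_le p.1).trans
        ((I.fst_lt_of_mem_normalize hc hp).le.trans (Nat.mul_le_mul_left _ hm.le)))
    rw [I.normalize.length_clause hc] at h
    rw [encodeClause, List.length_cons]
    exact Nat.succ_le_succ h
  · exact le_max_left _ _

/-! ### The running time -/

/-- The running time as a polynomial. -/
noncomputable def runTimePoly (w : ℕ) : Polynomial ℕ :=
  .X * (.X * (5 * .X + 6) + 4 * .X + 6 + 2 * (.C w + 2 * .X) + 3) + .X * (.X + 1) + 10 * .X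
    + 3 * .C w + 10

theorem eval_runTimePoly (w n : ℕ) : (runTimePoly w).eval n = runTime w n := by
  simp [runTimePoly, runTime, symbolTime, literalTime]

theorem initList_machine (w : ℕ) (a s : List Sym) :
    Turing.initList (machine w a) s = cfg .start false { inp := s } := by
  refine congrArg (Turing.TM2.Cfg.mk _ _) (funext fun k => ?_)
  cases k <;> rfl

theorem haltList_machine (w : ℕ) (a s : List Sym) :
    Turing.haltList (machine w a) s = halted { inp := s } := by
  refine congrArg (Turing.TM2.Cfg.mk _ _) (funext fun k => ?_)
  cases k <;> rfl

theorem outputs_of_reach {w n n' : ℕ} {a s s' u u' : List Sym}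
    (h : Reach w a n (cfg .start false { inp := s }) (halted { inp := s' })) (hu : u = s)
    (hu' : u' = s') (hn : n' = n) :
    Nonempty (Turing.TM2OutputsInTime (machine w a) u (some u') n') := by
  subst hu hu' hn
  rw [← initList_machine w a, ← haltList_machine w a] at h
  exact h

/-- The machine computes the kernel. -/
theorem reach_kernel {r : ℕ} (I : SatInstance r) :
    Reach (4 * r + 2) (singleClause r).encode (runTime (4 * r + 2) I.encode.length)
      (cfg .start false { inp := I.encode }) (halted { inp := (kernel r I).encode }) := by
  have h := reach_halted (w := 4 * r + 2) (a := (singleClause r).encode) I.num I.clauses rfl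
  have e : (kernel r I).encode = if I.clauses.length < 2 ^ threshold I
      then encodeNumber I.num ++ (renameClauses [] I.clauses).flatMap encodeClause
      else (singleClause r).encode := by
    rw [kernel]
    split_ifs
    · rw [SatInstance.encode, SatInstance.normalize_clauses]
      rfl
    · rfl
  rw [e]
  exact h

end ExactSat

theorem theorem3 (r : ℕ) (hr : 2 ≤ r) :
    ∃ f : (ExactSat.lowConflictSat r).Inst → (ExactSat.lowConflictSat r).Inst,
      (ExactSat.lowConflictSat r).IsKernelization f ∧
      ∀ I : (ExactSat.lowConflictSat r).Inst,
        ((ExactSat.lowConflictSat.formula (f I)).card : ℚ)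
            < 16 * 256 ^ r * (ExactSat.lowConflictSat r).param I ^ 2 ∧
        ∀ Y ∈ ExactSat.lowConflictSat.formula (f I), ∀ p ∈ Y,
          p.1 < r * (ExactSat.lowConflictSat.formula (f I)).card := by
  have hr0 : 0 < r := by omega
  refine ⟨fun I => ⟨ExactSat.kernel r I.1, ExactSat.kernel_lowConflict hr0 I.2⟩, ?_,
    fun I => ⟨ExactSat.kernel_card_lt I.1, ExactSat.kernel_fst_lt I.1⟩⟩
  refine ⟨⟨?_⟩, fun I => ExactSat.kernel_isYes hr0 I.2, fun I => ExactSat.kernel_k_le I.1, ?_⟩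
  · refine
      { tm := ExactSat.machine (4 * r + 2) (ExactSat.singleClause r).encode
        inputAlphabet := Equiv.refl _
        outputAlphabet := Equiv.refl _
        time := ExactSat.runTimePoly (4 * r + 2)
        outputsFun := fun I => ?_ }
    exact Classical.choice (ExactSat.outputs_of_reach (ExactSat.reach_kernel I.1)
      (List.map_id _) (List.map_id _) (ExactSat.eval_runTimePoly _ _))
  · obtain ⟨g, hg⟩ := ExactSat.kernel_size_le r
    exact ⟨g, fun I => hg I.1⟩
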